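/- **Setting.** An input consists of finitely many jobs to be scheduled preemptively on a single machine. Job $q$ has a release time $r_q\ge 0$, a processing time $p_q>0$ and an estimate $\tilde p_q>0$. Let $\mu_1=\max\{1,\max_q p_q/\tilde p_q\}$ and $\mu_2=\max\{1,\max_q \tilde p_q/p_q\}$ be the underestimation and overestimation factors; the *distortion* of the input is $\mu_1\mu_2$. A schedule processes at most one job at a time, and no job before its release; job $q$ completes at the first time $C_q$ by which it has been processed for $p_q$ time units. The *total flow time* is $\sum_q (C_q-r_q)$, and $\mathrm{OPT}$ is its infimum over all (offline) schedules. A job is *pending* at time $t$ if $r_q\le t<C_q$. The *class* of $q$ is the integer $i$ with $2^i\le\tilde p_q<2^{i+1}$. **The ZigZag algorithm.** Every pending job is either *full* (its initial mark) or *partial*; a partial job carries one of the marks *zig*, *zag*, *zigzag*. At every time at which some job is pending, the algorithm repeats the following (marking takes no time) until it processes a job. If there is no partial job, mark an arbitrary pending job of minimum class as zig and repeat. Otherwise let $q$ be the partial job of minimum class and $q'$ a pending job (full or partial) of minimum class. * If $q$ is zig and $q'$ has smaller class than $q$: mark $q'$ as zag and repeat. * If $q$ is zag: let $\hat q$ be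 the partial job of smallest class among those of class greater than that of $q$. If there is a full job whose class is at least that of $q$ and at most that of $\hat q$, change the mark of $q$ to zigzag and repeat. Otherwise, if $q'$ has smaller class than $q$ and some other pending job $q''\ne q'$ also has smaller class than $q$, mark $q'$ as zig and repeat. * If $q$ is zigzag and $q'$ has smaller class than $q$: mark $q'$ as zig and repeat. * In all remaining cases process $q$. The algorithm uses neither the processing times nor the distortion. **Theorem.** There is an absolute constant $C>0$ such that for every $\mu\ge 1$, every input of distortion at most $\mu$ (with both under- and overestimations allowed), and every way of breaking ties among minimum-class jobs in the ZigZag algorithm, the following hold. 1. The total flow time of the ZigZag algorithm is at most $C\,\mu\,(1+\log\mu)\cdot\mathrm{OPT}$. 2. For every schedule $S$ of the input and every time $t$, the number of jobs pending at $t$ in the ZigZag algorithm is at most $C\,\mu\,(1+\log\mu)$ times the number of jobs pending at $t$ in $S$. In particular this holds for an optimal $S$. For $\mu\ge 2$ the factor $C\,\mu\,(1+\log\mu)$ is $O(\mu\log\mu)$, so ZigZag is $O(\mu\log\mu)$-competitive without knowing $\mu$. -/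

import Mathlib

open scoped ENNReal

namespace ZigZagScheduling

/-- An input of the single-machine problem with `n` jobs: release times, real processing times and
estimated processing times. -/
structure Input (n : ℕ) where
  release : Fin n → ℝ
  proc : Fin n → ℝ
  est : Fin n → ℝ
  release_nonneg : ∀ q, 0 ≤ release q
  proc_pos : ∀ q, 0 < proc q
  est_pos : ∀ q, 0 < est q

namespace Input

variable {n : ℕ} (I : Input n)

/-- Maximum underestimation factor (at least `1`). -/
noncomputable def underestimation : ℝ := max 1 (⨆ q, I.proc q / I.est q)

/-- Maximum overestimation factor (at least `1`). -/
noncomputable def overestimation : ℝ := max 1 (⨆ q, I.est q / I.proc q)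

noncomputable def distortion : ℝ := I.underestimation * I.overestimation

/-- The class of `q`: the integer `i` with `2 ^ i ≤ est q < 2 ^ (i + 1)`. -/
noncomputable def cls (q : Fin n) : ℤ := Int.log 2 (I.est q)

theorem cls_spec (q : Fin n) :
    (2 : ℝ) ^ I.cls q ≤ I.est q ∧ I.est q < (2 : ℝ) ^ (I.cls q + 1) :=
  ⟨Int.zpow_log_le_self (by norm_num) (I.est_pos q),
    Int.lt_zpow_succ_log_self (by norm_num) (I.est q)⟩

end Input

/-- A feasible (preemptive, offline) schedule on a single machine: `slots q` is the set of times at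
which `q` is processed. At most one job is processed at any time, and none before its release. -/
structure Schedule {n : ℕ} (I : Input n) where
  slots : Fin n → Set ℝ
  measurableSet_slots : ∀ q, MeasurableSet (slots q)
  disjoint_slots : ∀ q q', q ≠ q' → Disjoint (slots q) (slots q')
  slots_subset : ∀ q, slots q ⊆ Set.Ici (I.release q)

namespace Schedule

variable {n : ℕ} {I : Input n} (S : Schedule I)

/-- The completion time of `q`: the first time by which `q` has received its whole processing time
(`⊤` if this never happens). -/
noncomputable def completion (q : Fin n) : ℝ≥0∞ :=
  ⨅ (t : ℝ) (_ : 0 ≤ t)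
    (_ : ENNReal.ofReal (I.proc q) ≤ MeasureTheory.volume (S.slots q ∩ Set.Iio t)),
    ENNReal.ofReal t

/-- The total flow time of the schedule. -/
noncomputable def totalFlow : ℝ≥0∞ := ∑ q, (S.completion q - ENNReal.ofReal (I.release q))

open scoped Classical in
/-- The number of jobs pending at time `t`: released, but not yet completed. -/
noncomputable def numPending (t : ℝ) : ℕ :=
  (Finset.univ.filter fun q => I.release q ≤ t ∧ ENNReal.ofReal t < S.completion q).card

end Schedule

/-- The optimal total flow time. -/
noncomputable def opt {n : ℕ} (I : Input n) : ℝ≥0∞ := ⨅ S : Schedule I, S.totalFlow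

/-- The marks of the jobs in the algorithm; a job is partial if it is not `full`. -/
inductive Status where
  | full
  | zig
  | zag
  | zigzag
deriving DecidableEq

/-- A configuration of the algorithm: current time, remaining volume and mark of every job. -/
structure State (n : ℕ) where
  time : ℝ
  rem : Fin n → ℝ
  status : Fin n → Status

/-- A rule resolving the arbitrary choices among minimum-class jobs. No state occurs twice in a run
before the last job is completed, so dependence on the state allows for all possible choices. -/
structure TieBreak (n : ℕ) where
  pick : State n → (s : Finset (Fin n)) → s.Nonempty → Fin n
  pick_mem : ∀ st s (h : s.Nonempty), pick st s h ∈ s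

/-- What the algorithm does in one iteration of its loop. -/
inductive Action (n : ℕ) where
  | mark (q : Fin n) (m : Status)
  | process (q : Fin n)
  | idle

section Algorithm

variable {n : ℕ} (I : Input n) (tb : TieBreak n)

open scoped Classical in
noncomputable def pendingJobs (st : State n) : Finset (Fin n) :=
  Finset.univ.filter fun q => I.release q ≤ st.time ∧ 0 < st.rem q

open scoped Classical in
noncomputable def partialJobs (st : State n) : Finset (Fin n) :=
  (pendingJobs I st).filter fun q => st.status q ≠ Status.full

theorem partialJobs_subset (st : State n) : partialJobs I st ⊆ pendingJobs I st := by
  unfold partialJobs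
  exact Finset.filter_subset _ _

open scoped Classical in
noncomputable def fullJobs (st : State n) : Finset (Fin n) :=
  (pendingJobs I st).filter fun q => st.status q = Status.full

open scoped Classical in
/-- The jobs of minimum class in `s`. -/
noncomputable def minClass (s : Finset (Fin n)) : Finset (Fin n) :=
  s.filter fun q => ∀ q' ∈ s, I.cls q ≤ I.cls q'

theorem minClass_nonempty {s : Finset (Fin n)} (h : s.Nonempty) : (minClass I s).Nonempty := by
  obtain ⟨q, hq, hmin⟩ := s.exists_min_image I.cls h
  exact ⟨q, by simpa [minClass] using ⟨hq, hmin⟩⟩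

/-- Choose a job of minimum class in `s`. -/
noncomputable def pickMin (st : State n) (s : Finset (Fin n)) (h : s.Nonempty) : Fin n :=
  tb.pick st (minClass I s) (minClass_nonempty I h)

theorem pickMin_mem (st : State n) (s : Finset (Fin n)) (h : s.Nonempty) :
    pickMin I tb st s h ∈ s :=
  (Finset.mem_filter.1 (tb.pick_mem st (minClass I s) (minClass_nonempty I h))).1

/-- There is a full job whose class lies between the class of `q` and the class of the partial job
`p` of smallest class above `q`. -/
def FullJobAbove (st : State n) (q : Fin n) : Prop :=
  ∃ p ∈ minClass I ((partialJobs I st).filter fun p => I.cls q < I.cls p),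
    ∃ f ∈ fullJobs I st, I.cls q ≤ I.cls f ∧ I.cls f ≤ I.cls p

open scoped Classical in
/-- One iteration of the loop of the ZigZag algorithm. It looks only at the estimates (through the
classes) and the marks of the pending jobs. -/
noncomputable def action (st : State n) : Action n :=
  if hpend : (pendingJobs I st).Nonempty then
    let q' := pickMin I tb st (pendingJobs I st) hpend
    if hpart : (partialJobs I st).Nonempty then
      let q := pickMin I tb st (partialJobs I st) hpart
      match st.status q with
      | Status.zig =>
        if I.cls q' < I.cls q then Action.mark q' Status.zag
        else Action.process q
      | Status.zag =>
        if FullJobAbove I st q then Action.mark q Status.zigzag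
        else if I.cls q' < I.cls q ∧ ∃ q'' ∈ pendingJobs I st, q'' ≠ q' ∧ I.cls q'' < I.cls q then
          Action.mark q' Status.zig
        else Action.process q
      | _ =>
        if I.cls q' < I.cls q then Action.mark q' Status.zig
        else Action.process q
    else Action.mark q' Status.zig
  else Action.idle

/-- The jobs that are released after time `t`. -/
noncomputable def futureJobs (t : ℝ) : Finset (Fin n) :=
  Finset.univ.filter fun q => t < I.release q

/-- Carry out an action. Marking takes no time. The decision to process `q` stays valid until `q` is
completed or a job is released, so `q` is processed until the first of these events; an idle machine
waits for the next release (forever, if there is none). -/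
noncomputable def perform (st : State n) : Action n → State n
  | Action.mark q m => { st with status := Function.update st.status q m }
  | Action.process q =>
    let d : ℝ := if h : (futureJobs I st.time).Nonempty then
      min (st.rem q) ((futureJobs I st.time).inf' h I.release - st.time) else st.rem q
    { st with time := st.time + d, rem := Function.update st.rem q (st.rem q - d) }
  | Action.idle =>
    { st with time := if h : (futureJobs I st.time).Nonempty then
        (futureJobs I st.time).inf' h I.release else st.time }

/-- The state of the algorithm after `k` iterations; it starts at time `0` with all jobs full. -/
noncomputable def run : ℕ → State n
  | 0 => { time := 0, rem := I.proc, status := fun _ => Status.full }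
  | k + 1 => perform I (run k) (action I tb (run k))

theorem mem_pendingJobs_of_action {st : State n} {q : Fin n}
    (h : action I tb st = Action.process q) : q ∈ pendingJobs I st := by
  unfold action at h
  split_ifs at h with h1 h2
  have hq : pickMin I tb st (partialJobs I st) h2 ∈ pendingJobs I st :=
    partialJobs_subset I st (pickMin_mem I tb st (partialJobs I st) h2)
  dsimp only at h
  split at h <;> split_ifs at h <;> (cases h; exact hq)

theorem time_le_inf' (t : ℝ) (h : (futureJobs I t).Nonempty) :
    t ≤ (futureJobs I t).inf' h I.release :=
  Finset.le_inf' _ _ fun _ hq => (Finset.mem_filter.1 hq).2.le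

theorem run_time_le_succ (k : ℕ) : (run I tb k).time ≤ (run I tb (k + 1)).time := by
  rw [run]
  cases ha : action I tb (run I tb k) with
  | mark _ _ => exact le_rfl
  | process q =>
    have hq := (Finset.mem_filter.1 (mem_pendingJobs_of_action I tb ha)).2.2
    simp only [perform]
    split_ifs with h
    · have := time_le_inf' I _ h
      have : 0 ≤ min ((run I tb k).rem q)
        ((futureJobs I (run I tb k).time).inf' h I.release - (run I tb k).time) :=
        le_min hq.le (by linarith)
      linarith
    · linarith
  | idle =>
    simp only [perform]
    split_ifs with h
    · exact time_le_inf' I _ h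
    · exact le_rfl

theorem run_time_mono : Monotone fun k => (run I tb k).time :=
  monotone_nat_of_le_succ (run_time_le_succ I tb)

/-- The schedule produced by the ZigZag algorithm. -/
noncomputable def zigzag : Schedule I where
  slots q := ⋃ k, ⋃ (_ : action I tb (run I tb k) = Action.process q),
    Set.Ico (run I tb k).time (run I tb (k + 1)).time
  measurableSet_slots q :=
    MeasurableSet.iUnion fun _ => MeasurableSet.iUnion fun _ => measurableSet_Ico
  disjoint_slots q q' hne := by
    rw [Set.disjoint_left]
    intro u hu hu'
    simp only [Set.mem_iUnion, Set.mem_Ico, exists_prop] at hu hu'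
    obtain ⟨j, hj, hj1, hj2⟩ := hu
    obtain ⟨k, hk, hk1, hk2⟩ := hu'
    rcases lt_trichotomy j k with h | h | h
    · have : (run I tb (j + 1)).time ≤ (run I tb k).time := run_time_mono I tb h
      linarith
    · subst h
      rw [hj] at hk
      exact hne (Action.process.inj hk)
    · have : (run I tb (k + 1)).time ≤ (run I tb j).time := run_time_mono I tb h
      linarith
  slots_subset q := by
    intro u hu
    simp only [Set.mem_iUnion, Set.mem_Ico, exists_prop] at hu
    obtain ⟨j, hj, hj1, _⟩ := hu
    exact (Finset.mem_filter.1 (mem_pendingJobs_of_action I tb hj)).2.1.trans hj1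

end Algorithm

end ZigZagScheduling

/-! The algorithm is compared with an arbitrary schedule `S` at each fixed time: it has at most
32·distortion times as many pending jobs as `S`. Total flow time is the integral of the number of
pending jobs, so this local bound implies the global one. The bound is linear in the distortion; of
the factor `1 + log μ` only its being at least 1 is used.

Counting. Partial jobs have distinct classes, a zag lies directly below a zig, and a new zig is
opened below a zag only if a further full job lies below that zag. A budget argument (`Coherent`)
then bounds the number of partial jobs by four times the number of full jobs plus 2, so it suffices
to count full jobs.

Volume. The excess at level `i` is the remaining work of class at most `i` minus that of `S`.
Processing the lowest pending job never creates positive excess. The only harmful step processes a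
zag while a single pending job has lower class; then all pending work below the zig above belongs to
these two jobs. Hence (`Controlled`) the excess is nonpositive just below every zig and above all
zigs, and at the levels whose next zig above is `Z` (the owner) it is bounded by the part of class
at most `i` of one set of at most two jobs depending on `Z` only.

Charging. If the excess is positive at a level owned by `Z`, it must fall to at most 0 just below
`Z`, so `S` has a pending job whose class is also owned by `Z` (`exists_pending_isOwner`). Different
owners thus charge different jobs of `S`. Now weigh work by 2^(-class), and let μ₁, μ₂ be the under-
and overestimation factors: every job weighs at most 2μ₁, a full job at least 1/μ₂. Summation by
parts turns the excess bounds into a weight of at most 4μ₁ per job pending in `S`, to which the jobs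
of `S` themselves add 2μ₁. So there are at most 6μ₁μ₂ full jobs per job of `S`, and 32 = 5·6 + 2. -/

namespace ZigZagScheduling

/-! ### Work, completion and flow time in an arbitrary schedule. -/

namespace Schedule

variable {n : ℕ} {I : Input n} (S : Schedule I)

/-- The amount of processing that `q` has received before time `t`. -/
noncomputable def work (q : Fin n) (t : ℝ) : ℝ :=
  (MeasureTheory.volume (S.slots q ∩ Set.Iio t)).toReal

/-- The remaining processing time of `q` at time `t`. -/
noncomputable def left (q : Fin n) (t : ℝ) : ℝ := max 0 (I.proc q - S.work q t)

theorem work_nonneg (q : Fin n) (t : ℝ) : 0 ≤ S.work q t := ENNReal.toReal_nonneg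

theorem volume_slots_ne_top (q : Fin n) (t : ℝ) :
    MeasureTheory.volume (S.slots q ∩ Set.Iio t) ≠ ∞ := by
  refine ne_top_of_le_ne_top ?_ (MeasureTheory.measure_mono (t := Set.Ico (I.release q) t)
    fun u hu => ⟨S.slots_subset q hu.1, hu.2⟩)
  simp

theorem ofReal_work (q : Fin n) (t : ℝ) :
    ENNReal.ofReal (S.work q t) = MeasureTheory.volume (S.slots q ∩ Set.Iio t) :=
  ENNReal.ofReal_toReal (S.volume_slots_ne_top q t)

theorem work_mono (q : Fin n) : Monotone (S.work q) := fun _ _ h =>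
  ENNReal.toReal_mono (S.volume_slots_ne_top q _)
    (MeasureTheory.measure_mono (Set.inter_subset_inter_right _ (Set.Iio_subset_Iio h)))

theorem work_eq_zero {q : Fin n} {t : ℝ} (h : t ≤ I.release q) : S.work q t = 0 := by
  have : S.slots q ∩ Set.Iio t = ∅ := by
    ext u
    simp only [Set.mem_inter_iff, Set.mem_Iio, Set.mem_empty_iff_false, iff_false, not_and, not_lt]
    exact fun hu => h.trans (S.slots_subset q hu)
  simp [work, this]

theorem left_eq_proc {q : Fin n} {t : ℝ} (h : t ≤ I.release q) : S.left q t = I.proc q := by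
  simp [left, S.work_eq_zero h, (I.proc_pos q).le]

theorem left_nonneg (q : Fin n) (t : ℝ) : 0 ≤ S.left q t := le_max_left _ _

theorem left_le_proc (q : Fin n) (t : ℝ) : S.left q t ≤ I.proc q :=
  max_le (I.proc_pos q).le (by linarith [S.work_nonneg q t])

theorem work_eq_add {q : Fin n} {s t : ℝ} (h : s ≤ t) :
    S.work q t = S.work q s + (MeasureTheory.volume (S.slots q ∩ Set.Ico s t)).toReal := by
  have hu : S.slots q ∩ Set.Iio t = (S.slots q ∩ Set.Iio s) ∪ (S.slots q ∩ Set.Ico s t) := by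
    rw [← Set.inter_union_distrib_left, Set.Iio_union_Ico_eq_Iio h]
  have hfin : MeasureTheory.volume (S.slots q ∩ Set.Ico s t) ≠ ∞ :=
    ne_top_of_le_ne_top (by simp) (MeasureTheory.measure_mono (Set.inter_subset_right))
  unfold work
  rw [hu, MeasureTheory.measure_union, ENNReal.toReal_add (S.volume_slots_ne_top q s) hfin]
  · rw [Set.disjoint_left]
    rintro u ⟨_, h1⟩ ⟨_, h2, _⟩
    exact absurd h1 (not_lt.2 h2)
  · exact (S.measurableSet_slots q).inter measurableSet_Ico

theorem sum_work_sub_le (A : Finset (Fin n)) {s t : ℝ} (h : s ≤ t) :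
    ∑ q ∈ A, (S.work q t - S.work q s) ≤ t - s := by
  have hfin : ∀ q, MeasureTheory.volume (S.slots q ∩ Set.Ico s t) ≠ ∞ := fun q =>
    ne_top_of_le_ne_top (by simp) (MeasureTheory.measure_mono (Set.inter_subset_right))
  have h1 : ∑ q ∈ A, (S.work q t - S.work q s) =
      (∑ q ∈ A, MeasureTheory.volume (S.slots q ∩ Set.Ico s t)).toReal := by
    rw [ENNReal.toReal_sum fun q _ => hfin q]
    exact Finset.sum_congr rfl fun q _ => by rw [S.work_eq_add h]; ring
  rw [h1, ← MeasureTheory.measure_biUnion_finset]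
  · refine ENNReal.toReal_le_of_le_ofReal (by linarith) ?_
    rw [← Real.volume_Ico]
    exact MeasureTheory.measure_mono (Set.iUnion₂_subset fun q _ => Set.inter_subset_right)
  · intro q _ q' _ hne
    exact (S.disjoint_slots q q' hne).mono Set.inter_subset_left Set.inter_subset_left
  · exact fun q _ => (S.measurableSet_slots q).inter measurableSet_Ico

theorem sum_left_sub_le (A : Finset (Fin n)) {s t : ℝ} (h : s ≤ t) :
    ∑ q ∈ A, (S.left q s - S.left q t) ≤ t - s := by
  refine (Finset.sum_le_sum fun q _ => ?_).trans (S.sum_work_sub_le A h)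
  have := S.work_mono q h
  unfold left
  rcases max_cases 0 (I.proc q - S.work q s) with h1 | h1 <;>
    rcases max_cases 0 (I.proc q - S.work q t) with h2 | h2 <;> linarith [h1.1, h2.1]

theorem continuous_work (q : Fin n) : Continuous (S.work q) := by
  have key : ∀ s t, s ≤ t → S.work q t - S.work q s ≤ t - s := fun s t h => by
    simpa using S.sum_work_sub_le {q} h
  refine (LipschitzWith.of_dist_le_mul (K := 1) fun s t => ?_).continuous
  rw [Real.dist_eq, Real.dist_eq, NNReal.coe_one, one_mul]
  rcases le_total s t with h | h
  · rw [abs_sub_comm, abs_of_nonneg (sub_nonneg.2 (S.work_mono q h)), abs_sub_comm s,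
      abs_of_nonneg (sub_nonneg.2 h)]
    exact key s t h
  · rw [abs_of_nonneg (sub_nonneg.2 (S.work_mono q h)), abs_of_nonneg (sub_nonneg.2 h)]
    exact key t s h

/-- At a nonnegative time `t`, a job is uncompleted exactly if it has work left. -/
theorem lt_completion_iff {q : Fin n} {t : ℝ} (ht : 0 ≤ t) :
    ENNReal.ofReal t < S.completion q ↔ 0 < S.left q t := by
  have hleft : 0 < S.left q t ↔ S.work q t < I.proc q := by simp [left]
  rw [hleft]
  constructor
  · intro h
    by_contra! hw
    refine absurd h (not_lt.2 (iInf₂_le_of_le t ht (iInf_le_of_le ?_ le_rfl)))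
    rw [← S.ofReal_work]
    exact ENNReal.ofReal_le_ofReal hw
  · intro h
    -- By continuity the job is still unfinished at some `u > t`, so the infimum defining its
    -- completion is at least `u`; this makes the inequality strict.
    obtain ⟨u, hu, htu⟩ : ∃ u, S.work q u < I.proc q ∧ t < u := by
      have h1 := (S.continuous_work q).continuousAt.eventually_lt_const h
      have h2 : ∀ᶠ u in nhdsWithin t (Set.Ioi t), S.work q u < I.proc q :=
        nhdsWithin_le_nhds h1
      exact (h2.and self_mem_nhdsWithin).exists
    refine (ENNReal.ofReal_lt_ofReal_iff_of_nonneg ht |>.2 htu).trans_le ?_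
    refine le_iInf fun v => le_iInf fun _ => le_iInf fun hv => ENNReal.ofReal_le_ofReal ?_
    by_contra! hvu
    rw [← S.ofReal_work, ENNReal.ofReal_le_ofReal_iff (S.work_nonneg q v)] at hv
    have := S.work_mono q hvu.le
    linarith

open scoped Classical in
theorem numPending_eq {t : ℝ} (ht : 0 ≤ t) :
    S.numPending t = (Finset.univ.filter fun q => I.release q ≤ t ∧ 0 < S.left q t).card := by
  unfold numPending
  congr 1
  ext q
  simp [S.lt_completion_iff ht]

theorem numPending_of_neg {t : ℝ} (ht : t < 0) : S.numPending t = 0 := by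
  unfold numPending
  rw [Finset.card_eq_zero, Finset.filter_eq_empty_iff]
  intro q _ h
  linarith [I.release_nonneg q, h.1]

/-- The total flow time is the integral of the number of pending jobs. -/
theorem totalFlow_eq_lintegral :
    S.totalFlow = ∫⁻ t : ℝ, (S.numPending t : ℝ≥0∞) := by
  classical
  have h1 : ∀ t : ℝ, (S.numPending t : ℝ≥0∞) =
      ∑ q, ({t : ℝ | I.release q ≤ t ∧ ENNReal.ofReal t < S.completion q}).indicator
        (fun _ => (1 : ℝ≥0∞)) t := by
    intro t
    simp only [numPending, Finset.card_filter, Nat.cast_sum, Set.indicator_apply,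
      Set.mem_ofPred_eq, Nat.cast_ite, Nat.cast_one, Nat.cast_zero]
  have hmeas : ∀ q, MeasurableSet
      {t : ℝ | I.release q ≤ t ∧ ENNReal.ofReal t < S.completion q} := fun q =>
    (measurableSet_le measurable_const measurable_id).inter
      (measurableSet_lt ENNReal.measurable_ofReal measurable_const)
  simp_rw [h1]
  rw [MeasureTheory.lintegral_finsetSum _ fun q _ => measurable_const.indicator (hmeas q)]
  refine Finset.sum_congr rfl fun q _ => ?_
  rw [MeasureTheory.lintegral_indicator (hmeas q), MeasureTheory.setLIntegral_one]
  by_cases hc : S.completion q = ∞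
  · have : {t : ℝ | I.release q ≤ t ∧ ENNReal.ofReal t < S.completion q} =
        Set.Ici (I.release q) := by
      ext t; simp [hc]
    rw [this, hc, Real.volume_Ici]
    simp
  · have : {t : ℝ | I.release q ≤ t ∧ ENNReal.ofReal t < S.completion q} =
        Set.Ico (I.release q) (S.completion q).toReal := by
      ext t
      simp only [Set.mem_ofPred_eq, Set.mem_Ico]
      refine and_congr_right fun ht => ?_
      rw [ENNReal.ofReal_lt_iff_lt_toReal ((I.release_nonneg q).trans ht) hc]
    rw [this, Real.volume_Ico, ENNReal.ofReal_sub _ (I.release_nonneg q), ENNReal.ofReal_toReal hc]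

end Schedule

/-! ### Decisions of the algorithm and the counting invariants. -/

section Structure

variable {n : ℕ} {I : Input n} {tb : TieBreak n} {st : State n}

theorem mem_pendingJobs {q : Fin n} :
    q ∈ pendingJobs I st ↔ I.release q ≤ st.time ∧ 0 < st.rem q := by
  simp [pendingJobs]

theorem mem_partialJobs {q : Fin n} :
    q ∈ partialJobs I st ↔ q ∈ pendingJobs I st ∧ st.status q ≠ Status.full := by
  simp [partialJobs]

theorem mem_fullJobs {q : Fin n} :
    q ∈ fullJobs I st ↔ q ∈ pendingJobs I st ∧ st.status q = Status.full := by
  simp [fullJobs]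

theorem mem_minClass {s : Finset (Fin n)} {q : Fin n} :
    q ∈ minClass I s ↔ q ∈ s ∧ ∀ q' ∈ s, I.cls q ≤ I.cls q' := by
  simp [minClass]

theorem card_pendingJobs :
    (pendingJobs I st).card = (partialJobs I st).card + (fullJobs I st).card := by
  classical
  rw [partialJobs, fullJobs, add_comm]
  exact (Finset.card_filter_add_card_filter_not _).symm

theorem cls_pickMin_le {s : Finset (Fin n)} (h : s.Nonempty) {q : Fin n} (hq : q ∈ s) :
    I.cls (pickMin I tb st s h) ≤ I.cls q :=
  (mem_minClass.1 (tb.pick_mem st (minClass I s) (minClass_nonempty I h))).2 q hq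

/-- What may be assumed about the state when the algorithm takes a given action. -/
inductive ActionSpec (I : Input n) (st : State n) : Action n → Prop
  | idle (h : pendingJobs I st = ∅) : ActionSpec I st Action.idle
  | markZig (q : Fin n) (hq : q ∈ pendingJobs I st)
      (hmin : ∀ p ∈ pendingJobs I st, I.cls q ≤ I.cls p)
      (hlt : ∀ p ∈ partialJobs I st, I.cls q < I.cls p)
      (h : partialJobs I st = ∅ ∨ ∃ m ∈ partialJobs I st,
        (∀ p ∈ partialJobs I st, I.cls m ≤ I.cls p) ∧ (st.status m = Status.zigzag ∨
          st.status m = Status.zag ∧ ∃ p ∈ pendingJobs I st, p ≠ q ∧ I.cls p < I.cls m)) :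
      ActionSpec I st (Action.mark q Status.zig)
  | markZag (q : Fin n) (hq : q ∈ pendingJobs I st)
      (hmin : ∀ p ∈ pendingJobs I st, I.cls q ≤ I.cls p)
      (hlt : ∀ p ∈ partialJobs I st, I.cls q < I.cls p)
      (h : ∃ m ∈ partialJobs I st,
        (∀ p ∈ partialJobs I st, I.cls m ≤ I.cls p) ∧ st.status m = Status.zig) :
      ActionSpec I st (Action.mark q Status.zag)
  | markZigzag (q : Fin n) (hq : q ∈ partialJobs I st)
      (hmin : ∀ p ∈ partialJobs I st, I.cls q ≤ I.cls p)
      (hzag : st.status q = Status.zag) (h : FullJobAbove I st q) :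
      ActionSpec I st (Action.mark q Status.zigzag)
  | process (q : Fin n) (hq : q ∈ partialJobs I st)
      (hmin : ∀ p ∈ partialJobs I st, I.cls q ≤ I.cls p)
      (h : (∀ p ∈ pendingJobs I st, I.cls q ≤ I.cls p) ∨
        st.status q = Status.zag ∧ ¬ FullJobAbove I st q ∧
          ∃ q', ∀ p ∈ pendingJobs I st, I.cls p < I.cls q → p = q') :
      ActionSpec I st (Action.process q)

theorem actionSpec_action : ActionSpec I st (action I tb st) := by
  unfold action
  split_ifs with hpend hpart
  · have hq := pickMin_mem I tb st _ hpart
    have hq' := pickMin_mem I tb st _ hpend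
    have hmin : ∀ p ∈ partialJobs I st, I.cls (pickMin I tb st _ hpart) ≤ I.cls p :=
      fun p => cls_pickMin_le hpart
    have hmin' : ∀ p ∈ pendingJobs I st, I.cls (pickMin I tb st _ hpend) ≤ I.cls p :=
      fun p => cls_pickMin_le hpend
    dsimp only
    generalize pickMin I tb st (partialJobs I st) hpart = q at *
    generalize pickMin I tb st (pendingJobs I st) hpend = q' at *
    split
    · split_ifs with hlt
      · exact .markZag q' hq' hmin' (fun p hp => hlt.trans_le (hmin p hp)) ⟨q, hq, hmin, ‹_›⟩
      · exact .process q hq hmin (.inl fun p hp => (not_lt.1 hlt).trans (hmin' p hp))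
    · split_ifs with hfull hlt
      · exact .markZigzag q hq hmin ‹_› hfull
      · exact .markZig q' hq' hmin' (fun p hp => hlt.1.trans_le (hmin p hp))
          (.inr ⟨q, hq, hmin, .inr ⟨‹_›, hlt.2⟩⟩)
      · refine .process q hq hmin (.inr ⟨‹_›, hfull, q', fun p hp hpq => ?_⟩)
        by_contra hne
        exact hlt ⟨(hmin' p hp).trans_lt hpq, p, hp, hne, hpq⟩
    · have hzz : st.status q = Status.zigzag := by
        have := (mem_partialJobs.1 hq).2
        cases h : st.status q <;> simp_all
      split_ifs with hlt
      · exact .markZig q' hq' hmin' (fun p hp => hlt.trans_le (hmin p hp))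
          (.inr ⟨q, hq, hmin, .inl hzz⟩)
      · exact .process q hq hmin (.inl fun p hp => (not_lt.1 hlt).trans (hmin' p hp))
  · rw [Finset.not_nonempty_iff_eq_empty] at hpart
    exact .markZig _ (pickMin_mem I tb st _ hpend)
      (fun p => cls_pickMin_le hpend)
      (by simp [hpart]) (.inl hpart)
  · exact .idle (Finset.not_nonempty_iff_eq_empty.1 hpend)

/-- The state after a job has been marked. -/
def setMark (st : State n) (q : Fin n) (m : Status) : State n :=
  { st with status := Function.update st.status q m }

/-- The state after `q` has been processed for `d` time units. -/
def advance (st : State n) (q : Fin n) (d : ℝ) : State n :=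
  { st with time := st.time + d, rem := Function.update st.rem q (st.rem q - d) }

/-- The state after waiting until time `t`. -/
def wait (st : State n) (t : ℝ) : State n := { st with time := t }

/-- Number of partial jobs of class at least `c`. -/
noncomputable def partialCount (I : Input n) (st : State n) (c : ℤ) : ℕ :=
  ((partialJobs I st).filter fun q => c ≤ I.cls q).card

/-- Number of full jobs of class at least `c`, those of class above `c` counted twice. -/
noncomputable def fullCount (I : Input n) (st : State n) (c : ℤ) : ℕ :=
  ((fullJobs I st).filter fun q => c ≤ I.cls q).card +
    ((fullJobs I st).filter fun q => c < I.cls q).card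

/-- The slack that a mark permits in the comparison of `partialCount` with `fullCount`. -/
def Status.allowance : Status → ℕ
  | full => 0
  | zig => 1
  | zag => 2
  | zigzag => 0

/-- The invariants of the algorithm that do not refer to other schedules. -/
structure Coherent (I : Input n) (st : State n) : Prop where
  rem_nonneg : ∀ q, 0 ≤ st.rem q
  rem_le_proc : ∀ q, st.rem q ≤ I.proc q
  rem_of_full : ∀ q, st.status q = Status.full → st.rem q = I.proc q
  full_of_unreleased : ∀ q, st.time < I.release q → st.status q = Status.full
  cls_inj : ∀ p ∈ partialJobs I st, ∀ q ∈ partialJobs I st, I.cls p = I.cls q → p = q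
  zag_below_zig : ∀ z ∈ partialJobs I st, st.status z = Status.zag →
    ∃ Z ∈ partialJobs I st, st.status Z = Status.zig ∧ I.cls z < I.cls Z ∧
      ∀ p ∈ partialJobs I st, I.cls z < I.cls p → I.cls Z ≤ I.cls p
  partialCount_le : ∀ q ∈ partialJobs I st,
    partialCount I st (I.cls q) ≤ 2 * fullCount I st (I.cls q) + (st.status q).allowance

theorem fullCount_antitone : Antitone (fullCount I st) := fun _ _ h =>
  add_le_add
    (Finset.card_le_card (Finset.monotone_filter_right _ fun _ _ hp => h.trans hp))
    (Finset.card_le_card (Finset.monotone_filter_right _ fun _ _ hp => h.trans_lt hp))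

/-- This is what the double count is for: `f` counts once at its own class and twice below it, so
going down from `b` to `a` gains something even if `f` sits at either end of the interval. -/
theorem fullCount_lt {a b : ℤ} {f : Fin n} (hf : f ∈ fullJobs I st) (hab : a < b)
    (ha : a ≤ I.cls f) (hb : I.cls f ≤ b) : fullCount I st b < fullCount I st a := by
  unfold fullCount
  rcases hb.lt_or_eq with h | h
  · refine add_lt_add_of_lt_of_le (Finset.card_lt_card ?_)
      (Finset.card_le_card (Finset.monotone_filter_right _ fun _ _ hp => hab.trans hp))
    refine (Finset.ssubset_iff_of_subset
      (Finset.monotone_filter_right _ fun _ _ hp => hab.le.trans hp)).2 ⟨f, ?_, ?_⟩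
    · simp [hf, ha]
    · simp [h]
  · refine add_lt_add_of_le_of_lt
      (Finset.card_le_card (Finset.monotone_filter_right _ fun _ _ hp => hab.le.trans hp))
      (Finset.card_lt_card ?_)
    refine (Finset.ssubset_iff_of_subset
      (Finset.monotone_filter_right _ fun _ _ hp => hab.trans hp)).2 ⟨f, ?_, ?_⟩
    · simp [hf, h, hab]
    · simp [h]

end Structure

/-! ### Preservation of the counting invariants. -/

section Structure

variable {n : ℕ} {I : Input n} {st : State n}

theorem pendingJobs_setMark {q : Fin n} {m : Status} :
    pendingJobs I (setMark st q m) = pendingJobs I st := rfl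

theorem mem_partialJobs_setMark {q : Fin n} {m : Status} (hq : q ∈ pendingJobs I st)
    (hm : m ≠ Status.full) {p : Fin n} :
    p ∈ partialJobs I (setMark st q m) ↔ p = q ∨ p ∈ partialJobs I st := by
  rw [mem_partialJobs, mem_partialJobs, pendingJobs_setMark]
  rcases eq_or_ne p q with rfl | h
  · simp [setMark, hq, hm]
  · simp [setMark, h]

theorem mem_fullJobs_setMark {q : Fin n} {m : Status} (hm : m ≠ Status.full) {p : Fin n} :
    p ∈ fullJobs I (setMark st q m) ↔ p ≠ q ∧ p ∈ fullJobs I st := by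
  rw [mem_fullJobs, mem_fullJobs, pendingJobs_setMark]
  rcases eq_or_ne p q with rfl | h
  · simp [setMark, hm]
  · simp [setMark, h]

theorem status_setMark_self {q : Fin n} {m : Status} : (setMark st q m).status q = m := by
  simp [setMark]

theorem status_setMark_of_ne {q p : Fin n} {m : Status} (h : p ≠ q) :
    (setMark st q m).status p = st.status p := by
  simp [setMark, h]

theorem partialCount_setMark {q : Fin n} {m : Status} (hq : q ∈ pendingJobs I st)
    (hm : m ≠ Status.full) {c : ℤ} (h : I.cls q < c ∨ q ∈ partialJobs I st) :
    partialCount I (setMark st q m) c = partialCount I st c := by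
  unfold partialCount
  congr 1
  ext p
  simp only [Finset.mem_filter, mem_partialJobs_setMark hq hm]
  rcases eq_or_ne p q with rfl | hp
  · rcases h with h | h
    · simp [not_le.2 h]
    · simp [h]
  · simp [hp]

theorem fullCount_setMark {q : Fin n} {m : Status} (hm : m ≠ Status.full) {c : ℤ}
    (h : I.cls q < c ∨ q ∈ partialJobs I st) :
    fullCount I (setMark st q m) c = fullCount I st c := by
  have key : ∀ p, c ≤ I.cls p → (p ∈ fullJobs I (setMark st q m) ↔ p ∈ fullJobs I st) := by
    intro p hp
    rw [mem_fullJobs_setMark hm, and_iff_right_iff_imp]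
    rintro hf rfl
    rcases h with h | h
    · exact absurd hp (not_le.2 h)
    · exact (mem_partialJobs.1 h).2 (mem_fullJobs.1 hf).2
  unfold fullCount
  congr 2 <;> ext p <;> simp only [Finset.mem_filter]
  · exact and_congr_left fun hp => key p hp
  · exact and_congr_left fun hp => key p (le_of_lt hp)

theorem partialCount_setMark_self {q m : Fin n} {s : Status} (hq : q ∈ pendingJobs I st)
    (hs : s ≠ Status.full) (hm : ∀ p ∈ partialJobs I st, I.cls m ≤ I.cls p) :
    partialCount I (setMark st q s) (I.cls q) ≤ partialCount I st (I.cls m) + 1 := by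
  classical
  unfold partialCount
  refine (Finset.card_le_card (t := insert q _) fun p hp => ?_).trans (Finset.card_insert_le q _)
  rw [Finset.mem_filter, mem_partialJobs_setMark hq hs] at hp
  rw [Finset.mem_insert, Finset.mem_filter]
  exact hp.1.imp_right fun h => ⟨h, hm p h⟩

/-- Since partial jobs have distinct classes, `z` is the only one in the gap between its own class
and that of `Z`. -/
theorem Coherent.partialCount_le_succ (h : Coherent I st) {z Z : Fin n}
    (hz : z ∈ partialJobs I st)
    (hZ : ∀ p ∈ partialJobs I st, I.cls z < I.cls p → I.cls Z ≤ I.cls p) :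
    partialCount I st (I.cls z) ≤ partialCount I st (I.cls Z) + 1 := by
  classical
  unfold partialCount
  refine (Finset.card_le_card (t := insert z _) fun p hp => ?_).trans (Finset.card_insert_le z _)
  rw [Finset.mem_filter] at hp
  rw [Finset.mem_insert, Finset.mem_filter]
  rcases hp.2.lt_or_eq with h1 | h1
  · exact .inr ⟨hp.1, hZ p hp.1 h1⟩
  · exact .inl (h.cls_inj p hp.1 z hz h1.symm)

/-- Marking a full job of smaller class than all partial jobs preserves coherence, if the new mark
is compatible with the mark of the lowest partial job. -/
theorem Coherent.setMark_of_lt (h : Coherent I st) {q : Fin n} {s : Status}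
    (hs : s ≠ Status.full) (hq : q ∈ pendingJobs I st)
    (hlt : ∀ p ∈ partialJobs I st, I.cls q < I.cls p)
    (hzag : s = Status.zag → ∃ Z ∈ partialJobs I st, st.status Z = Status.zig ∧
      ∀ p ∈ partialJobs I st, I.cls Z ≤ I.cls p)
    (hcount : partialCount I (setMark st q s) (I.cls q) ≤
      2 * fullCount I (setMark st q s) (I.cls q) + s.allowance) :
    Coherent I (setMark st q s) where
  rem_nonneg := h.rem_nonneg
  rem_le_proc := h.rem_le_proc
  rem_of_full p hp := by
    rcases eq_or_ne p q with rfl | hpq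
    · exact absurd (status_setMark_self.symm.trans hp) hs
    · exact h.rem_of_full p (status_setMark_of_ne hpq ▸ hp)
  full_of_unreleased p hp := by
    rcases eq_or_ne p q with rfl | hpq
    · exact absurd (mem_pendingJobs.1 hq).1 (not_le.2 hp)
    · rw [status_setMark_of_ne hpq]
      exact h.full_of_unreleased p hp
  cls_inj p hp r hr hpr := by
    rw [mem_partialJobs_setMark hq hs] at hp hr
    rcases hp with rfl | hp <;> rcases hr with rfl | hr
    · rfl
    · exact absurd hpr (hlt r hr).ne
    · exact absurd hpr (hlt p hp).ne'
    · exact h.cls_inj p hp r hr hpr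
  zag_below_zig z hz hzz := by
    simp only [mem_partialJobs_setMark hq hs] at hz ⊢
    rcases eq_or_ne z q with rfl | hzq
    · rw [status_setMark_self] at hzz
      obtain ⟨Z, hZ, hZs, hZm⟩ := hzag hzz
      refine ⟨Z, .inr hZ, ?_, hlt Z hZ, ?_⟩
      · rwa [status_setMark_of_ne (fun e => (hlt Z hZ).ne (by rw [e]))]
      · rintro p (rfl | hp) hzp
        · exact absurd hzp (lt_irrefl _)
        · exact hZm p hp
    · rw [status_setMark_of_ne hzq] at hzz
      obtain ⟨Z, hZ, hZs, hzZ, hZm⟩ := h.zag_below_zig z (hz.resolve_left hzq) hzz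
      refine ⟨Z, .inr hZ, ?_, hzZ, ?_⟩
      · rwa [status_setMark_of_ne (fun e => (hlt Z hZ).ne (by rw [e]))]
      · rintro p (rfl | hp) hzp
        · exact absurd (hlt z (hz.resolve_left hzq)) hzp.asymm
        · exact hZm p hp hzp
  partialCount_le p hp := by
    rw [mem_partialJobs_setMark hq hs] at hp
    rcases eq_or_ne p q with rfl | hpq
    · rwa [status_setMark_self]
    · have hp := hp.resolve_left hpq
      rw [status_setMark_of_ne hpq, partialCount_setMark hq hs (.inl (hlt p hp)),
        fullCount_setMark hs (.inl (hlt p hp))]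
      exact h.partialCount_le p hp

/-- Below a zigzag the new job uses up the single unit that a zig is allowed. Below a zag the slack
would grow to 3, but the second lower pending job is full and raises `fullCount` by at least one,
which pays for two units. -/
theorem Coherent.markZig (h : Coherent I st) {q : Fin n} (hq : q ∈ pendingJobs I st)
    (hmin : ∀ p ∈ pendingJobs I st, I.cls q ≤ I.cls p)
    (hlt : ∀ p ∈ partialJobs I st, I.cls q < I.cls p)
    (hm : partialJobs I st = ∅ ∨ ∃ m ∈ partialJobs I st,
      (∀ p ∈ partialJobs I st, I.cls m ≤ I.cls p) ∧ (st.status m = Status.zigzag ∨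
        st.status m = Status.zag ∧ ∃ p ∈ pendingJobs I st, p ≠ q ∧ I.cls p < I.cls m)) :
    Coherent I (setMark st q Status.zig) := by
  have hs : Status.zig ≠ Status.full := by simp
  refine h.setMark_of_lt hs hq hlt (by simp) ?_
  rcases hm with hm | ⟨m, hm, hmm, hst⟩
  · have : partialCount I (setMark st q Status.zig) (I.cls q) ≤ 1 := by
      unfold partialCount
      refine (Finset.card_le_card (t := {q}) fun p hp => ?_).trans (Finset.card_singleton q).le
      rw [Finset.mem_filter, mem_partialJobs_setMark hq hs, hm] at hp
      simpa using hp.1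
    simp only [Status.allowance]
    omega
  · have h1 := partialCount_setMark_self (s := Status.zig) hq hs hmm
    have h2 := h.partialCount_le m hm
    have h3 := fullCount_setMark (st := st) hs (.inl (hlt m hm))
    rcases hst with hst | ⟨hst, f, hf, hfq, hfm⟩
    · have h4 := fullCount_antitone (I := I) (st := setMark st q Status.zig) (hlt m hm).le
      simp only [hst, Status.allowance] at h2 ⊢
      omega
    · have hff : f ∈ fullJobs I (setMark st q Status.zig) := by
        rw [mem_fullJobs_setMark hs]
        refine ⟨hfq, mem_fullJobs.2 ⟨hf, ?_⟩⟩
        by_contra hne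
        exact absurd hfm (not_lt.2 (hmm f (mem_partialJobs.2 ⟨hf, hne⟩)))
      have h4 := fullCount_lt hff (hlt m hm) (hmin f hf) hfm.le
      simp only [hst, Status.allowance] at h2 ⊢
      omega

theorem Coherent.markZag (h : Coherent I st) {q m : Fin n} (hq : q ∈ pendingJobs I st)
    (hlt : ∀ p ∈ partialJobs I st, I.cls q < I.cls p) (hm : m ∈ partialJobs I st)
    (hmm : ∀ p ∈ partialJobs I st, I.cls m ≤ I.cls p) (hst : st.status m = Status.zig) :
    Coherent I (setMark st q Status.zag) := by
  have hs : Status.zag ≠ Status.full := by simp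
  refine h.setMark_of_lt hs hq hlt (fun _ => ⟨m, hm, hst, hmm⟩) ?_
  have h1 := partialCount_setMark_self (s := Status.zag) hq hs hmm
  have h2 := h.partialCount_le m hm
  have h3 := fullCount_setMark (st := st) hs (.inl (hlt m hm))
  have h4 := fullCount_antitone (I := I) (st := setMark st q Status.zag) (hlt m hm).le
  simp only [hst, Status.allowance] at h2 ⊢
  omega

/-- The zig above has slack 1 and the zag adds one job. The full job between them raises
`fullCount`, and its two units bring the slack down to 0. -/
theorem Coherent.markZigzag (h : Coherent I st) {q : Fin n} (hq : q ∈ partialJobs I st)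
    (hzag : st.status q = Status.zag) (hfull : FullJobAbove I st q) :
    Coherent I (setMark st q Status.zigzag) := by
  have hs : Status.zigzag ≠ Status.full := by simp
  have hqp := (mem_partialJobs.1 hq).1
  have hpart : ∀ p, p ∈ partialJobs I (setMark st q Status.zigzag) ↔ p ∈ partialJobs I st := by
    intro p
    rw [mem_partialJobs_setMark hqp hs, or_iff_right_iff_imp]
    rintro rfl
    exact hq
  have hne : ∀ p ∈ partialJobs I st, st.status p = Status.zig → p ≠ q := by
    rintro p _ hp rfl
    simp [hzag] at hp
  refine ⟨h.rem_nonneg, h.rem_le_proc, fun p hp => ?_, fun p hp => ?_, ?_, fun z hz hzz => ?_,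
    fun p hp => ?_⟩
  · rcases eq_or_ne p q with rfl | hpq
    · exact absurd (status_setMark_self.symm.trans hp) hs
    · exact h.rem_of_full p (status_setMark_of_ne hpq ▸ hp)
  · rcases eq_or_ne p q with rfl | hpq
    · exact absurd (mem_pendingJobs.1 hqp).1 (not_le.2 hp)
    · rw [status_setMark_of_ne hpq]
      exact h.full_of_unreleased p hp
  · simpa only [hpart] using h.cls_inj
  · simp only [hpart] at hz ⊢
    rcases eq_or_ne z q with rfl | hzq
    · simp [status_setMark_self] at hzz
    · rw [status_setMark_of_ne hzq] at hzz
      obtain ⟨Z, hZ, hZs, hZ'⟩ := h.zag_below_zig z hz hzz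
      exact ⟨Z, hZ, by rwa [status_setMark_of_ne (hne Z hZ hZs)], hZ'⟩
  · rw [hpart] at hp
    rw [partialCount_setMark hqp hs (.inr hq), fullCount_setMark hs (.inr hq)]
    rcases eq_or_ne p q with rfl | hpq
    · obtain ⟨Z, hZ, hZs, hpZ, hZm⟩ := h.zag_below_zig p hp hzag
      obtain ⟨r, hr, f, hf, hf1, hf2⟩ := hfull
      rw [mem_minClass] at hr
      have hfZ : I.cls f ≤ I.cls Z := hf2.trans (hr.2 Z (by simp [hZ, hpZ]))
      have h1 := h.partialCount_le_succ hp hZm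
      have h2 := fullCount_lt hf hpZ hf1 hfZ
      have h3 := h.partialCount_le Z hZ
      simp only [hZs, status_setMark_self, Status.allowance] at h3 ⊢
      omega
    · rw [status_setMark_of_ne hpq]
      exact h.partialCount_le p hp

theorem Coherent.mem_partialJobs_advance (h : Coherent I st) {q : Fin n} {d : ℝ} (hd : 0 ≤ d)
    {p : Fin n} :
    p ∈ partialJobs I (advance st q d) ↔
      p ∈ partialJobs I st ∧ (p = q → d < st.rem q) := by
  have hrel : st.status p ≠ Status.full → I.release p ≤ st.time := fun hp => by
    by_contra! hlt
    exact hp (h.full_of_unreleased p hlt)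
  simp only [mem_partialJobs, mem_pendingJobs, advance]
  constructor
  · rintro ⟨⟨h1, h2⟩, h3⟩
    rcases eq_or_ne p q with rfl | hpq
    · rw [Function.update_self] at h2
      exact ⟨⟨⟨hrel h3, by linarith⟩, h3⟩, fun _ => by linarith⟩
    · rw [Function.update_of_ne hpq] at h2
      exact ⟨⟨⟨hrel h3, h2⟩, h3⟩, fun e => absurd e hpq⟩
  · rintro ⟨⟨⟨h1, h2⟩, h3⟩, h4⟩
    refine ⟨⟨by linarith, ?_⟩, h3⟩
    rcases eq_or_ne p q with rfl | hpq
    · rw [Function.update_self]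
      linarith [h4 rfl]
    · rwa [Function.update_of_ne hpq]

theorem partialCount_mono {st' : State n} (h : partialJobs I st' ⊆ partialJobs I st) (c : ℤ) :
    partialCount I st' c ≤ partialCount I st c :=
  Finset.card_le_card (Finset.filter_subset_filter _ h)

theorem fullCount_mono {st' : State n} (h : fullJobs I st ⊆ fullJobs I st') (c : ℤ) :
    fullCount I st c ≤ fullCount I st' c :=
  add_le_add (Finset.card_le_card (Finset.filter_subset_filter _ h))
    (Finset.card_le_card (Finset.filter_subset_filter _ h))

/-- Processing the partial job of minimum class preserves coherence. -/
theorem Coherent.advance (h : Coherent I st) {q : Fin n} {d : ℝ} (hd : 0 ≤ d)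
    (hdq : d ≤ st.rem q) (hq : q ∈ partialJobs I st)
    (hmin : ∀ p ∈ partialJobs I st, I.cls q ≤ I.cls p) :
    Coherent I (advance st q d) := by
  have hsub : partialJobs I (ZigZagScheduling.advance st q d) ⊆ partialJobs I st :=
    fun p hp => ((h.mem_partialJobs_advance hd).1 hp).1
  have hfull : fullJobs I st ⊆ fullJobs I (ZigZagScheduling.advance st q d) := by
    intro p hp
    have hpq : p ≠ q := by
      rintro rfl
      exact (mem_partialJobs.1 hq).2 (mem_fullJobs.1 hp).2
    simp only [mem_fullJobs, mem_pendingJobs, ZigZagScheduling.advance,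
      Function.update_of_ne hpq] at hp ⊢
    exact ⟨⟨by linarith [hp.1.1], hp.1.2⟩, hp.2⟩
  refine ⟨fun p => ?_, fun p => ?_, fun p hp => ?_, fun p hp => ?_, ?_, fun z hz hzz => ?_,
    fun p hp => ?_⟩
  · simp only [ZigZagScheduling.advance, Function.update_apply]
    split_ifs
    · linarith
    · exact h.rem_nonneg p
  · simp only [ZigZagScheduling.advance, Function.update_apply]
    split_ifs with e
    · subst e
      linarith [h.rem_le_proc p]
    · exact h.rem_le_proc p
  · have hpq : p ≠ q := by
      rintro rfl
      exact (mem_partialJobs.1 hq).2 hp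
    simp only [ZigZagScheduling.advance, Function.update_of_ne hpq]
    exact h.rem_of_full p hp
  · simp only [ZigZagScheduling.advance] at hp ⊢
    exact h.full_of_unreleased p (by linarith)
  · exact fun p hp r hr => h.cls_inj p (hsub hp) r (hsub hr)
  · obtain ⟨Z, hZ, hZs, hzZ, hZm⟩ := h.zag_below_zig z (hsub hz) hzz
    refine ⟨Z, (h.mem_partialJobs_advance hd).2 ⟨hZ, ?_⟩, hZs, hzZ, fun p hp => hZm p (hsub hp)⟩
    -- A zig directly above a surviving zag is not of minimum class, so it cannot be the job being
    -- completed.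
    rintro rfl
    exact absurd (hmin z (hsub hz)) (not_le.2 hzZ)
  -- Completions can only lower the left side of the budget, and releases can only raise the right
  -- side.
  · have h1 := h.partialCount_le p (hsub hp)
    have h2 := partialCount_mono hsub (I.cls p)
    have h3 := fullCount_mono hfull (I.cls p)
    change _ ≤ _ + (st.status p).allowance
    omega

theorem Coherent.partialJobs_wait (h : Coherent I st) (he : pendingJobs I st = ∅) (t : ℝ) :
    partialJobs I (wait st t) = ∅ := by
  rw [Finset.eq_empty_iff_forall_notMem]
  intro p hp
  simp only [mem_partialJobs, mem_pendingJobs, wait] at hp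
  have hrel : I.release p ≤ st.time := by
    by_contra! hlt
    exact hp.2 (h.full_of_unreleased p hlt)
  have : p ∈ pendingJobs I st := mem_pendingJobs.2 ⟨hrel, hp.1.2⟩
  simp [he] at this

/-- Waiting while nothing is pending preserves coherence. -/
theorem Coherent.wait (h : Coherent I st) (he : pendingJobs I st = ∅) {t : ℝ}
    (ht : st.time ≤ t) : Coherent I (wait st t) where
  rem_nonneg := h.rem_nonneg
  rem_le_proc := h.rem_le_proc
  rem_of_full := h.rem_of_full
  full_of_unreleased p hp := h.full_of_unreleased p (lt_of_le_of_lt ht hp)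
  cls_inj := by simp [h.partialJobs_wait he]
  zag_below_zig := by simp [h.partialJobs_wait he]
  partialCount_le := by simp [h.partialJobs_wait he]

/-- At the lowest partial job the budget covers all partial jobs; `fullCount` counts each full job
at most twice and the allowance is at most 2. -/
theorem Coherent.card_pendingJobs_le (h : Coherent I st) :
    (pendingJobs I st).card ≤ 5 * (fullJobs I st).card + 2 := by
  have hpart : (partialJobs I st).card ≤ 4 * (fullJobs I st).card + 2 := by
    rcases (partialJobs I st).eq_empty_or_nonempty with he | hne
    · simp [he]
    · obtain ⟨m, hm, hmin⟩ := (partialJobs I st).exists_min_image I.cls hne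
      have h1 := h.partialCount_le m hm
      have h2 : partialCount I st (I.cls m) = (partialJobs I st).card := by
        rw [partialCount, Finset.filter_true_of_mem hmin]
      have h3 : fullCount I st (I.cls m) ≤ (fullJobs I st).card + (fullJobs I st).card :=
        add_le_add (Finset.card_filter_le _ _) (Finset.card_filter_le _ _)
      have h4 : (st.status m).allowance ≤ 2 := by
        cases st.status m <;> simp [Status.allowance]
      omega
  rw [card_pendingJobs]
  omega

end Structure

/-! ### Comparison of remaining volumes with another schedule. -/

section Excess

variable {n : ℕ} {I : Input n} (S : Schedule I) {st : State n}

/-- How much more work on jobs of class at most `i` is left in the state than in `S`. -/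
noncomputable def excess (st : State n) (i : ℤ) : ℝ :=
  ∑ q with I.cls q ≤ i, (st.rem q - S.left q st.time)

/-- Jobs outside `P` contribute nothing positive: they are finished, or untouched by both sides. The
weak inequality for the release admits jobs that arrive at this very moment. -/
theorem excess_le_sum {i : ℤ} {P : Finset (Fin n)}
    (hP : ∀ q ∉ P, st.rem q = 0 ∨ st.rem q = I.proc q ∧ st.time ≤ I.release q) :
    excess S st i ≤ ∑ q ∈ P with I.cls q ≤ i, st.rem q := by
  classical
  have h1 : ∑ q ∈ P with I.cls q ≤ i, st.rem q =
      ∑ q with I.cls q ≤ i, if q ∈ P then st.rem q else 0 := by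
    rw [← Finset.sum_filter, Finset.filter_filter]
    congr 1
    ext q
    simp [and_comm]
  rw [h1]
  refine Finset.sum_le_sum fun q _ => ?_
  split_ifs with hq
  · linarith [S.left_nonneg q st.time]
  · rcases hP q hq with h | ⟨h, h'⟩
    · linarith [S.left_nonneg q st.time]
    · rw [h, S.left_eq_proc h', sub_self]

theorem excess_nonpos {i : ℤ} {P : Finset (Fin n)}
    (hP : ∀ q ∉ P, st.rem q = 0 ∨ st.rem q = I.proc q ∧ st.time ≤ I.release q)
    (hi : ∀ q ∈ P, i < I.cls q) : excess S st i ≤ 0 := by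
  refine (excess_le_sum S hP).trans (le_of_eq ?_)
  rw [Finset.filter_false_of_mem fun q hq => not_le.2 (hi q hq), Finset.sum_empty]

theorem Coherent.rem_eq_of_notMem_pendingJobs (h : Coherent I st) {q : Fin n}
    (hq : q ∉ pendingJobs I st) :
    st.rem q = 0 ∨ st.rem q = I.proc q ∧ st.time < I.release q := by
  rw [mem_pendingJobs, not_and_or, not_le, not_lt] at hq
  rcases hq with hq | hq
  · exact .inr ⟨h.rem_of_full q (h.full_of_unreleased q hq), hq⟩
  · exact .inl (le_antisymm hq (h.rem_nonneg q))

/-- The algorithm removes `d` units of work of class at most `i`, while `S` can remove at most `d`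
in the same time. -/
theorem excess_advance_le {q : Fin n} {d : ℝ} (hd : 0 ≤ d) {i : ℤ} (hi : I.cls q ≤ i) :
    excess S (advance st q d) i ≤ excess S st i := by
  classical
  have h1 := S.sum_left_sub_le (Finset.univ.filter fun q => I.cls q ≤ i)
    (le_add_of_nonneg_right hd : st.time ≤ st.time + d)
  have h2 : ∑ p with I.cls p ≤ i, (advance st q d).rem p =
      ∑ p with I.cls p ≤ i, st.rem p - d := by
    have hq : q ∈ Finset.univ.filter fun q => I.cls q ≤ i := by simp [hi]
    simp only [advance]
    rw [Finset.sum_update_of_mem hq, ← Finset.add_sum_erase _ _ hq, Finset.sdiff_singleton_eq_erase]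
    ring
  unfold excess
  rw [Finset.sum_sub_distrib, Finset.sum_sub_distrib] at *
  rw [h2]
  change _ - ∑ p with I.cls p ≤ i, S.left p (st.time + d) ≤ _
  linarith

/-- `Z` is a pending zig. -/
def IsZig (I : Input n) (st : State n) (Z : Fin n) : Prop :=
  Z ∈ partialJobs I st ∧ st.status Z = Status.zig

/-- `Z` is the lowest zig of class above `i`. -/
def IsOwner (I : Input n) (st : State n) (i : ℤ) (Z : Fin n) : Prop :=
  IsZig I st Z ∧ i < I.cls Z ∧ ∀ Z', IsZig I st Z' → i < I.cls Z' → I.cls Z ≤ I.cls Z'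

/-- The invariants of the algorithm that compare it with the schedule `S`. -/
structure Controlled (st : State n) : Prop where
  below_zig : ∀ Z, IsZig I st Z → excess S st (I.cls Z - 1) ≤ 0
  above_zigs : ∀ i, (∀ Z, IsZig I st Z → I.cls Z ≤ i) → excess S st i ≤ 0
  -- The set `B` is chosen before `i`: one set has to serve all levels owned by `Z`.
  owner : ∀ Z, IsZig I st Z → ∃ B : Finset (Fin n), B.card ≤ 2 ∧ ∀ i, IsOwner I st i Z →
    excess S st i ≤ ∑ q ∈ B with I.cls q ≤ i, I.proc q

variable {S}

theorem sum_proc_nonneg (B : Finset (Fin n)) : 0 ≤ ∑ q ∈ B, I.proc q :=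
  Finset.sum_nonneg fun q _ => (I.proc_pos q).le

theorem Controlled.congr {st' : State n} (h : Controlled S st)
    (hz : ∀ Z, IsZig I st' Z ↔ IsZig I st Z) (he : excess S st' = excess S st) :
    Controlled S st' where
  below_zig Z hZ := he ▸ h.below_zig Z ((hz Z).1 hZ)
  above_zigs i hi := he ▸ h.above_zigs i fun Z hZ => hi Z ((hz Z).2 hZ)
  owner Z hZ := by
    obtain ⟨B, hB, hB'⟩ := h.owner Z ((hz Z).1 hZ)
    refine ⟨B, hB, fun i hi => he ▸ hB' i ?_⟩
    simpa only [IsOwner, hz] using hi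

theorem Controlled.setMark_of_not_zig (h : Controlled S st) {q : Fin n} {m : Status}
    (hq : q ∈ pendingJobs I st) (hm : m ≠ Status.full) (hm' : m ≠ Status.zig)
    (hs : st.status q ≠ Status.zig) : Controlled S (setMark st q m) := by
  refine h.congr (fun Z => ?_) rfl
  unfold IsZig
  rw [mem_partialJobs_setMark hq hm]
  rcases eq_or_ne Z q with rfl | hZ
  · simp [status_setMark_self, hm', hs]
  · rw [status_setMark_of_ne hZ]
    simp [hZ]

/-- The new zig has minimum class among the pending jobs, so there is no pending work below it and
its own levels need only the empty set. All other levels keep their owner. -/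
theorem Controlled.markZig (h : Controlled S st) (hc : Coherent I st) {q : Fin n}
    (hq : q ∈ pendingJobs I st) (hmin : ∀ p ∈ pendingJobs I st, I.cls q ≤ I.cls p)
    (hlt : ∀ p ∈ partialJobs I st, I.cls q < I.cls p) :
    Controlled S (setMark st q Status.zig) := by
  have hz : ∀ Z, IsZig I (setMark st q Status.zig) Z ↔ Z = q ∨ IsZig I st Z := by
    intro Z
    unfold IsZig
    rw [mem_partialJobs_setMark hq (by simp)]
    rcases eq_or_ne Z q with rfl | hZ
    · simp [status_setMark_self]
    · rw [status_setMark_of_ne hZ]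
      simp [hZ]
  have hbelow : ∀ i, i < I.cls q → excess S st i ≤ 0 := fun i hi =>
    excess_nonpos S (fun p hp => (hc.rem_eq_of_notMem_pendingJobs hp).imp_right
      (And.imp_right le_of_lt)) fun p hp => hi.trans_le (hmin p hp)
  refine ⟨fun Z hZ => ?_, fun i hi => ?_, fun Z hZ => ?_⟩
  · rcases (hz Z).1 hZ with rfl | hZ
    · exact hbelow _ (by omega)
    · exact h.below_zig Z hZ
  · exact h.above_zigs i fun Z hZ => hi Z ((hz Z).2 (.inr hZ))
  · rcases (hz Z).1 hZ with rfl | hZ'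
    · exact ⟨∅, by simp, fun i hi => (hbelow i hi.2.1).trans (sum_proc_nonneg _)⟩
    · obtain ⟨B, hB, hB'⟩ := h.owner Z hZ'
      refine ⟨B, hB, fun i hi => hB' i ⟨hZ', hi.2.1, fun Z' hZ'' => ?_⟩⟩
      exact hi.2.2 Z' ((hz Z').2 (.inr hZ''))

/-- Levels from the class of `q` upwards gain no excess. If `q` is the lowest pending job, lower
levels carry no pending work at all. If `q` is a zag, lower levels may gain, but they are all owned
by the zig directly above `q`, whose set is replaced. -/
theorem Controlled.advance (h : Controlled S st) (hc : Coherent I st) {q : Fin n} {d : ℝ}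
    (hd : 0 ≤ d) (hdq : d ≤ st.rem q)
    (hrel : ∀ p, st.time < I.release p → st.time + d ≤ I.release p)
    (hq : q ∈ partialJobs I st) (hmin : ∀ p ∈ partialJobs I st, I.cls q ≤ I.cls p)
    (hact : (∀ p ∈ pendingJobs I st, I.cls q ≤ I.cls p) ∨
      st.status q = Status.zag ∧ ¬ FullJobAbove I st q ∧
        ∃ q', ∀ p ∈ pendingJobs I st, I.cls p < I.cls q → p = q') :
    Controlled S (advance st q d) := by
  have hzig : ∀ Z, IsZig I (ZigZagScheduling.advance st q d) Z ↔
      IsZig I st Z ∧ (Z = q → d < st.rem q) := by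
    intro Z
    unfold IsZig
    rw [hc.mem_partialJobs_advance hd]
    exact and_right_comm
  have hc' := hc.advance hd hdq hq hmin
  have hrem : ∀ p ∉ pendingJobs I st, (ZigZagScheduling.advance st q d).rem p = 0 ∨
      (ZigZagScheduling.advance st q d).rem p = I.proc p ∧
        (ZigZagScheduling.advance st q d).time ≤ I.release p := by
    intro p hp
    have hpq : p ≠ q := by
      rintro rfl
      exact hp (mem_partialJobs.1 hq).1
    simp only [ZigZagScheduling.advance, Function.update_of_ne hpq]
    exact (hc.rem_eq_of_notMem_pendingJobs hp).imp_right (And.imp_right (hrel p))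
  have hqZ : ∀ Z, IsZig I st Z → I.cls q ≤ I.cls Z := fun Z hZ => hmin Z hZ.1
  rcases hact with hact | ⟨hzag, hfull, q', hq'⟩
  · have hbelow : ∀ i, i < I.cls q → excess S (ZigZagScheduling.advance st q d) i ≤ 0 :=
      fun i hi => excess_nonpos S hrem fun p hp => hi.trans_le (hact p hp)
    refine ⟨fun Z hZ => ?_, fun i hi => ?_, fun Z hZ => ?_⟩
    · have hZ := ((hzig Z).1 hZ).1
      rcases (hqZ Z hZ).eq_or_lt with e | hlt
      · exact hbelow _ (by omega)
      · exact (excess_advance_le S hd (by omega)).trans (h.below_zig Z hZ)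
    · rcases lt_or_ge i (I.cls q) with hiq | hiq
      · exact hbelow i hiq
      · refine (excess_advance_le S hd hiq).trans (h.above_zigs i fun Z hZ => ?_)
        by_cases hZq : Z = q
        · rwa [hZq]
        · exact hi Z ((hzig Z).2 ⟨hZ, fun e => absurd e hZq⟩)
    · have hZ := ((hzig Z).1 hZ).1
      obtain ⟨B, hB, hB'⟩ := h.owner Z hZ
      refine ⟨B, hB, fun i hi => ?_⟩
      rcases lt_or_ge i (I.cls q) with hiq | hiq
      · exact (hbelow i hiq).trans (sum_proc_nonneg _)
      · refine (excess_advance_le S hd hiq).trans (hB' i ⟨hZ, hi.2.1, fun Z' hZ' hiZ' => ?_⟩)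
        -- If `q` is a zig and gets completed, it lies at or below level `i`, so its disappearance
        -- does not affect the owner of `i`.
        refine hi.2.2 Z' ((hzig Z').2 ⟨hZ', ?_⟩) hiZ'
        rintro rfl
        exact absurd hiq (not_le.2 hiZ')
  · obtain ⟨Y, hY, hYs, hqY, hYm⟩ := hc.zag_below_zig q hq hzag
    have hzig' : ∀ Z, IsZig I (ZigZagScheduling.advance st q d) Z ↔ IsZig I st Z := by
      intro Z
      rw [hzig, and_iff_left_iff_imp]
      rintro ⟨_, hZ⟩ rfl
      simp [hzag] at hZ
    have hlt : ∀ Z, IsZig I st Z → I.cls q < I.cls Z := by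
      refine fun Z hZ => lt_of_le_of_ne (hqZ Z hZ) fun e => ?_
      have := hc.cls_inj q hq Z hZ.1 e
      subst this
      simp [IsZig, hzag] at hZ
    have hYZ : ∀ Z, IsZig I st Z → I.cls Y ≤ I.cls Z := fun Z hZ => hYm Z hZ.1 (hlt Z hZ)
    refine ⟨fun Z hZ => ?_, fun i hi => ?_, fun Z hZ => ?_⟩
    · rw [hzig'] at hZ
      have := hlt Z hZ
      exact (excess_advance_le S hd (by omega)).trans (h.below_zig Z hZ)
    · simp only [hzig'] at hi
      exact (excess_advance_le S hd (hqY.le.trans (hi Y ⟨hY, hYs⟩))).trans (h.above_zigs i hi)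
    · rw [hzig'] at hZ
      simp only [IsOwner, hzig']
      rcases (hYZ Z hZ).eq_or_lt with e | hYZ
      · have := hc.cls_inj Y hY Z hZ.1 e
        subst this
        -- Below `Y` only `q` and `q'` can be pending: a full job from the class of `q` upwards
        -- would contradict `hfull`, another partial job the position of `Y` directly above `q`.
        refine ⟨{q, q'}, Finset.card_le_two, fun i hi => (excess_le_sum S hrem).trans ?_⟩
        refine (Finset.sum_le_sum fun p _ => hc'.rem_le_proc p).trans
          (Finset.sum_le_sum_of_subset_of_nonneg (fun p hp => ?_) fun p _ _ => (I.proc_pos p).le)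
        rw [Finset.mem_filter] at hp ⊢
        refine ⟨?_, hp.2⟩
        rw [Finset.mem_insert, Finset.mem_singleton]
        rcases lt_or_ge (I.cls p) (I.cls q) with hpq | hpq
        · exact .inr (hq' p hp.1 hpq)
        · left
          have hpart : p ∈ partialJobs I st := by
            refine mem_partialJobs.2 ⟨hp.1, fun hpf => hfull ⟨Y, ?_, p, ?_, hpq, ?_⟩⟩
            · rw [mem_minClass]
              simp only [Finset.mem_filter]
              exact ⟨⟨hY, hqY⟩, fun r hr => hYm r hr.1 hr.2⟩
            · exact mem_fullJobs.2 ⟨hp.1, hpf⟩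
            · exact (hp.2.trans_lt hi.2.1).le
          rcases hpq.eq_or_lt with e | hpq
          · exact hc.cls_inj p hpart q hq e.symm
          · exact absurd (hp.2.trans_lt hi.2.1) (not_lt.2 (hYm p hpart hpq))
      · obtain ⟨B, hB, hB'⟩ := h.owner Z hZ
        refine ⟨B, hB, fun i hi => (excess_advance_le S hd ?_).trans (hB' i hi)⟩
        -- A level below `q` would be owned by the lower zig `Y` instead of `Z`.
        by_contra! hiq
        exact absurd (hi.2.2 Y ⟨hY, hYs⟩ (hiq.trans hqY)) (not_le.2 hYZ)

theorem Controlled.wait (hc : Coherent I st) (he : pendingJobs I st = ∅) {t : ℝ}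
    (hrel : ∀ p, st.time < I.release p → t ≤ I.release p) :
    Controlled S (wait st t) := by
  have hz : ∀ Z, ¬ IsZig I (ZigZagScheduling.wait st t) Z := fun Z hZ => by
    have := hZ.1
    simp [hc.partialJobs_wait he] at this
  refine ⟨fun Z hZ => absurd hZ (hz Z), fun i _ => ?_, fun Z hZ => absurd hZ (hz Z)⟩
  exact excess_nonpos S (P := ∅) (fun p _ =>
    (hc.rem_eq_of_notMem_pendingJobs (by simp [he])).imp_right (And.imp_right (hrel p))) (by simp)

end Excess

/-! ### Invariants along the run, termination, and states at arbitrary times. -/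

section Run

variable {n : ℕ} {I : Input n} {tb : TieBreak n} {st : State n}

theorem mem_futureJobs {t : ℝ} {q : Fin n} : q ∈ futureJobs I t ↔ t < I.release q := by
  simp [futureJobs]

theorem perform_process {q : Fin n} (hq : q ∈ pendingJobs I st) :
    ∃ d, perform I st (Action.process q) = advance st q d ∧ 0 ≤ d ∧ d ≤ st.rem q ∧
      (∀ p, st.time < I.release p → st.time + d ≤ I.release p) ∧
      (d = st.rem q ∨ ∃ p, st.time < I.release p ∧ st.time + d = I.release p) := by
  have hrem := (mem_pendingJobs.1 hq).2
  by_cases h : (futureJobs I st.time).Nonempty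
  · refine ⟨min (st.rem q) ((futureJobs I st.time).inf' h I.release - st.time), ?_,
      le_min hrem.le (sub_nonneg.2 (time_le_inf' I _ h)), min_le_left _ _, fun p hp => ?_, ?_⟩
    · simp only [perform, dif_pos h]
      rfl
    · have h1 := Finset.inf'_le I.release (mem_futureJobs.2 hp)
      have h2 := min_le_right (st.rem q) ((futureJobs I st.time).inf' h I.release - st.time)
      linarith
    · rcases min_choice (st.rem q) ((futureJobs I st.time).inf' h I.release - st.time) with e | e
      · exact .inl e
      · obtain ⟨p, hp, hp'⟩ := Finset.exists_mem_eq_inf' h I.release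
        exact .inr ⟨p, mem_futureJobs.1 hp, by rw [e, hp']; ring⟩
  · refine ⟨st.rem q, ?_, hrem.le, le_rfl, fun p hp => absurd ⟨p, mem_futureJobs.2 hp⟩ h, .inl rfl⟩
    simp only [perform, dif_neg h]
    rfl

theorem perform_idle :
    ∃ t, perform I st Action.idle = wait st t ∧ st.time ≤ t ∧
      (∀ p, st.time < I.release p → t ≤ I.release p) ∧
      (futureJobs I st.time = ∅ ∨ ∃ p, st.time < I.release p ∧ t = I.release p) := by
  by_cases h : (futureJobs I st.time).Nonempty
  · refine ⟨(futureJobs I st.time).inf' h I.release, ?_, time_le_inf' I _ h,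
      fun p hp => Finset.inf'_le I.release (mem_futureJobs.2 hp), .inr ?_⟩
    · simp only [perform, dif_pos h]
      rfl
    · obtain ⟨p, hp, hp'⟩ := Finset.exists_mem_eq_inf' h I.release
      exact ⟨p, mem_futureJobs.1 hp, hp'⟩
  · refine ⟨st.time, ?_, le_rfl, fun p hp => hp.le, .inl (Finset.not_nonempty_iff_eq_empty.1 h)⟩
    simp only [perform, dif_neg h]
    rfl

theorem work_zigzag_add_le {k : ℕ} {q : Fin n} (ha : action I tb (run I tb k) = Action.process q)
    {d : ℝ} (hd : 0 ≤ d) (hd' : (run I tb k).time + d ≤ (run I tb (k + 1)).time) :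
    (zigzag I tb).work q (run I tb k).time + d ≤ (zigzag I tb).work q ((run I tb k).time + d) := by
  rw [(zigzag I tb).work_eq_add (le_add_of_nonneg_right hd)]
  have hsub : Set.Ico (run I tb k).time ((run I tb k).time + d) ⊆
      (zigzag I tb).slots q ∩ Set.Ico (run I tb k).time ((run I tb k).time + d) := by
    refine fun u hu => ⟨?_, hu⟩
    simp only [zigzag, Set.mem_iUnion, exists_prop]
    exact ⟨k, ha, hu.1, hu.2.trans_le hd'⟩
  have h1 := ENNReal.toReal_mono (ne_top_of_le_ne_top (by simp)
    (MeasureTheory.measure_mono Set.inter_subset_right)) (MeasureTheory.measure_mono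
      (μ := MeasureTheory.volume) hsub)
  rw [Real.volume_Ico, add_sub_cancel_left, ENNReal.toReal_ofReal hd] at h1
  linarith

/-- A state that satisfies all invariants and whose jobs have received the amount of work that they
receive in the schedule of the algorithm. -/
structure Reachable (tb : TieBreak n) (S : Schedule I) (st : State n) : Prop where
  coherent : Coherent I st
  controlled : Controlled S st
  -- One direction suffices: a job unfinished in the schedule then has positive `rem`.
  proc_le : ∀ q, I.proc q ≤ st.rem q + (zigzag I tb).work q st.time

variable {S : Schedule I}

theorem reachable_zero : Reachable tb S (run I tb 0) := by
  have hpart : partialJobs I (run I tb 0) = ∅ := by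
    rw [Finset.eq_empty_iff_forall_notMem]
    exact fun p hp => (mem_partialJobs.1 hp).2 rfl
  have hz : ∀ Z, ¬ IsZig I (run I tb 0) Z := fun Z hZ => by simpa [hpart] using hZ.1
  refine ⟨⟨fun q => (I.proc_pos q).le, fun q => le_rfl, fun q _ => rfl, fun q _ => rfl,
    by simp [hpart], by simp [hpart], by simp [hpart]⟩,
    ⟨fun Z hZ => absurd hZ (hz Z), fun i _ => ?_, fun Z hZ => absurd hZ (hz Z)⟩, fun q => ?_⟩
  · exact excess_nonpos S (P := ∅) (fun q _ => .inr ⟨rfl, I.release_nonneg q⟩) (by simp)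
  · exact le_add_of_nonneg_right ((zigzag I tb).work_nonneg q _)

theorem Reachable.setMark (h : Reachable tb S st) {q : Fin n} {m : Status}
    (hs : ActionSpec I st (Action.mark q m)) : Reachable tb S (setMark st q m) := by
  have hfull : ∀ {q}, q ∈ pendingJobs I st → (∀ p ∈ partialJobs I st, I.cls q < I.cls p) →
      st.status q ≠ Status.zig := fun hq hlt e =>
    lt_irrefl _ (hlt _ (mem_partialJobs.2 ⟨hq, by simp [e]⟩))
  cases hs with
  | markZig _ hq hmin hlt hm =>
    exact ⟨h.coherent.markZig hq hmin hlt hm, h.controlled.markZig h.coherent hq hmin hlt,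
      h.proc_le⟩
  | markZag _ hq hmin hlt hm =>
    obtain ⟨m, hm, hmm, hst⟩ := hm
    exact ⟨h.coherent.markZag hq hlt hm hmm hst,
      h.controlled.setMark_of_not_zig hq (by simp) (by simp) (hfull hq hlt), h.proc_le⟩
  | markZigzag _ hq hmin hzag hf =>
    exact ⟨h.coherent.markZigzag hq hzag hf,
      h.controlled.setMark_of_not_zig (mem_partialJobs.1 hq).1 (by simp) (by simp) (by simp [hzag]),
      h.proc_le⟩

theorem Reachable.wait (h : Reachable tb S st) (he : pendingJobs I st = ∅) {t : ℝ}
    (ht : st.time ≤ t) (hrel : ∀ p, st.time < I.release p → t ≤ I.release p) :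
    Reachable tb S (wait st t) :=
  ⟨h.coherent.wait he ht, Controlled.wait h.coherent he hrel, fun q => (h.proc_le q).trans
    (add_le_add le_rfl ((zigzag I tb).work_mono q ht))⟩

/-- Any initial portion `d` of the iteration is allowed, so that times strictly between two
iterations are covered too. -/
theorem Reachable.advance {k : ℕ} (h : Reachable tb S (run I tb k)) {q : Fin n}
    (ha : action I tb (run I tb k) = Action.process q) {d : ℝ} (hd : 0 ≤ d)
    (hd' : (run I tb k).time + d ≤ (run I tb (k + 1)).time) :
    Reachable tb S (advance (run I tb k) q d) := by
  obtain ⟨e, he, _, he1, he2, _⟩ := perform_process (mem_pendingJobs_of_action I tb ha)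
  have hde : d ≤ e := by
    rw [run, ha, he] at hd'
    simpa [ZigZagScheduling.advance] using hd'
  have hspec := actionSpec_action (I := I) (tb := tb) (st := run I tb k)
  rw [ha] at hspec
  cases hspec with
  | process _ hq hmin hact =>
    refine ⟨h.coherent.advance hd (hde.trans he1) hq hmin,
      h.controlled.advance h.coherent hd (hde.trans he1)
        (fun p hp => by linarith [he2 p hp]) hq hmin hact, fun p => ?_⟩
    have h1 := h.proc_le p
    rcases eq_or_ne p q with rfl | hpq
    · have h2 := work_zigzag_add_le ha hd hd'
      simp only [ZigZagScheduling.advance, Function.update_self]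
      linarith
    · have h2 := (zigzag I tb).work_mono p (le_add_of_nonneg_right hd : (run I tb k).time ≤ _)
      simp only [ZigZagScheduling.advance, Function.update_of_ne hpq]
      linarith

theorem reachable_run (k : ℕ) : Reachable tb S (run I tb k) := by
  induction k with
  | zero => exact reachable_zero
  | succ k ih =>
    have hspec := actionSpec_action (I := I) (tb := tb) (st := run I tb k)
    cases ha : action I tb (run I tb k) with
    | mark q m =>
      rw [ha] at hspec
      rw [run, ha]
      exact ih.setMark hspec
    | process q =>
      obtain ⟨d, he, hd, _⟩ := perform_process (mem_pendingJobs_of_action I tb ha)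
      have hr : run I tb (k + 1) = advance (run I tb k) q d := by rw [run, ha, he]
      rw [hr]
      exact ih.advance ha hd (by rw [hr]; exact le_rfl)
    | idle =>
      rw [ha] at hspec
      obtain ⟨t, he, ht, hrel, _⟩ := perform_idle (I := I) (st := run I tb k)
      rw [run, ha, he]
      cases hspec with
      | idle h => exact ih.wait h ht hrel

/-- The number of marks that a job may still receive. -/
def Status.rank : Status → ℕ
  | full => 2
  | zig => 0
  | zag => 1
  | zigzag => 0

open scoped Classical in
/-- A bound on the number of iterations before the algorithm waits forever. -/
noncomputable def potential (I : Input n) (st : State n) : ℕ :=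
  (futureJobs I st.time).card + (Finset.univ.filter fun q => 0 < st.rem q).card +
    ∑ q, (st.status q).rank

theorem card_futureJobs_le {s t : ℝ} (h : s ≤ t) :
    (futureJobs I t).card ≤ (futureJobs I s).card :=
  Finset.card_le_card fun _ hp => mem_futureJobs.2 (h.trans_lt (mem_futureJobs.1 hp))

theorem card_futureJobs_lt {s : ℝ} {p : Fin n} (h : s < I.release p) :
    (futureJobs I (I.release p)).card < (futureJobs I s).card :=
  Finset.card_lt_card ((Finset.ssubset_iff_of_subset
    fun _ hp => mem_futureJobs.2 (h.trans (mem_futureJobs.1 hp))).2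
      ⟨p, mem_futureJobs.2 h, fun hp => lt_irrefl _ (mem_futureJobs.1 hp)⟩)

theorem potential_setMark {q : Fin n} {m : Status} (h : m.rank < (st.status q).rank) :
    potential I (setMark st q m) < potential I st := by
  refine Nat.add_lt_add_left (Finset.sum_lt_sum (fun p _ => ?_) ⟨q, Finset.mem_univ q, ?_⟩) _
  · rcases eq_or_ne p q with rfl | hpq
    · rw [status_setMark_self]
      exact h.le
    · rw [status_setMark_of_ne hpq]
  · rwa [status_setMark_self]

theorem potential_lt {k : ℕ}
    (h : ¬ (action I tb (run I tb k) = Action.idle ∧ futureJobs I (run I tb k).time = ∅)) :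
    potential I (run I tb (k + 1)) < potential I (run I tb k) := by
  classical
  have hspec := actionSpec_action (I := I) (tb := tb) (st := run I tb k)
  cases ha : action I tb (run I tb k) with
  | mark q m =>
    rw [ha] at hspec
    rw [run, ha]
    have hfull : ∀ {q}, q ∈ pendingJobs I (run I tb k) →
        (∀ p ∈ partialJobs I (run I tb k), I.cls q < I.cls p) →
        (run I tb k).status q = Status.full := fun {q} hq hlt => by
      by_contra e
      exact lt_irrefl _ (hlt q (mem_partialJobs.2 ⟨hq, e⟩))
    refine potential_setMark ?_
    cases hspec with
    | markZig _ hq _ hlt => simp [hfull hq hlt, Status.rank]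
    | markZag _ hq _ hlt => simp [hfull hq hlt, Status.rank]
    | markZigzag _ _ _ hzag => simp [hzag, Status.rank]
  | process q =>
    have hq := mem_pendingJobs_of_action I tb ha
    obtain ⟨d, he, hd, hdq, _, hev⟩ := perform_process hq
    rw [run, ha, he]
    refine Nat.add_lt_add_right ?_ _
    have hsub : (Finset.univ.filter fun p => 0 < (advance (run I tb k) q d).rem p) ⊆
        Finset.univ.filter fun p => 0 < (run I tb k).rem p := by
      intro p hp
      simp only [advance, Finset.mem_filter, Finset.mem_univ, true_and, Function.update_apply]
        at hp ⊢
      split_ifs at hp with e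
      · subst e
        linarith
      · exact hp
    -- Processing ends with a completion or a release; either one strictly lowers its term of the
    -- potential.
    rcases hev with rfl | ⟨p, hp, hp'⟩
    · refine add_lt_add_of_le_of_lt (card_futureJobs_le (le_add_of_nonneg_right hd))
        (Finset.card_lt_card ((Finset.ssubset_iff_of_subset hsub).2 ⟨q, ?_, ?_⟩))
      · simpa using (mem_pendingJobs.1 hq).2
      · simp [advance]
    · refine add_lt_add_of_lt_of_le ?_ (Finset.card_le_card hsub)
      change (futureJobs I ((run I tb k).time + d)).card < _
      rw [hp']
      exact card_futureJobs_lt hp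
  | idle =>
    obtain ⟨t, he, ht, hrel, hev⟩ := perform_idle (I := I) (st := run I tb k)
    rw [run, ha, he]
    rcases hev with hev | ⟨p, hp, rfl⟩
    · exact absurd ⟨ha, hev⟩ h
    · exact Nat.add_lt_add_right (Nat.add_lt_add_right (card_futureJobs_lt hp) _) _

/-- The algorithm eventually waits forever. -/
theorem exists_idle_forever :
    ∃ k, action I tb (run I tb k) = Action.idle ∧ futureJobs I (run I tb k).time = ∅ := by
  by_contra! hne
  have key : ∀ k, potential I (run I tb k) + k ≤ potential I (run I tb 0) := by
    intro k
    induction k with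
    | zero => exact le_rfl
    | succ k ih =>
      have := potential_lt fun h : _ ∧ _ => (hne k h.1).ne_empty h.2
      omega
  have := key (potential I (run I tb 0) + 1)
  omega

/-- A time passed by some iteration is reached by cutting the first such iteration short. By
termination, every other time is reached by waiting after the final iteration. -/
theorem exists_reachable (tb : TieBreak n) (S : Schedule I) {t : ℝ} (ht : 0 ≤ t) :
    ∃ st, st.time = t ∧ Reachable tb S st := by
  have hidle : ∀ {k}, action I tb (run I tb k) = Action.idle → pendingJobs I (run I tb k) = ∅ := by
    intro k ha
    have hspec := actionSpec_action (I := I) (tb := tb) (st := run I tb k)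
    rw [ha] at hspec
    cases hspec with
    | idle h => exact h
  obtain ⟨K, hK, hK'⟩ := exists_idle_forever (I := I) (tb := tb)
  rcases le_or_gt (run I tb K).time t with h | h
  · refine ⟨wait (run I tb K) t, rfl, (reachable_run K).wait (hidle hK) h fun p hp => ?_⟩
    have := mem_futureJobs.2 hp
    simp [hK'] at this
  · classical
    have hex : ∃ k, t < (run I tb k).time := ⟨K, h⟩
    obtain ⟨k, hk⟩ : ∃ k, Nat.find hex = k + 1 := by
      refine Nat.exists_eq_succ_of_ne_zero fun h0 => ?_
      have := Nat.find_spec hex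
      rw [h0] at this
      exact absurd this (not_lt.2 ht)
    have h1 : t < (run I tb (k + 1)).time := hk ▸ Nat.find_spec hex
    have h2 : (run I tb k).time ≤ t := not_lt.1 (Nat.find_min hex (hk ▸ Nat.lt_succ_self k))
    cases ha : action I tb (run I tb k) with
    | mark q m =>
      rw [run, ha] at h1
      exact absurd h1 (not_lt.2 h2)
    | process q =>
      refine ⟨advance (run I tb k) q (t - (run I tb k).time), ?_,
        (reachable_run k).advance ha (sub_nonneg.2 h2) (by linarith)⟩
      simp [advance]
    | idle =>
      obtain ⟨u, he, _, hrel, _⟩ := perform_idle (I := I) (st := run I tb k)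
      rw [run, ha, he] at h1
      exact ⟨wait (run I tb k) t, rfl, (reachable_run k).wait (hidle ha) h2
        fun p hp => h1.le.trans (hrel p hp)⟩

theorem Reachable.numPending_le (h : Reachable tb S st) (ht : 0 ≤ st.time) :
    (zigzag I tb).numPending st.time ≤ (pendingJobs I st).card := by
  classical
  rw [Schedule.numPending_eq _ ht]
  refine Finset.card_le_card fun q hq => ?_
  simp only [Finset.mem_filter, Finset.mem_univ, true_and] at hq
  refine mem_pendingJobs.2 ⟨hq.1, ?_⟩
  have h1 := h.proc_le q
  have h2 : 0 < I.proc q - (zigzag I tb).work q st.time := by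
    simpa [Schedule.left] using hq.2
  linarith

end Run

/-! ### Weights by negative powers of two and summation by parts. -/

namespace Input

variable {n : ℕ} (I : Input n)

theorem one_le_underestimation : 1 ≤ I.underestimation := le_max_left _ _

theorem one_le_overestimation : 1 ≤ I.overestimation := le_max_left _ _

theorem one_le_distortion : 1 ≤ I.distortion :=
  one_le_mul_of_one_le_of_one_le I.one_le_underestimation I.one_le_overestimation

theorem proc_le_underestimation_mul (q : Fin n) : I.proc q ≤ I.underestimation * I.est q := by
  rw [← div_le_iff₀ (I.est_pos q)]
  exact (le_ciSup (f := fun q => I.proc q / I.est q) (Set.finite_range _).bddAbove q).trans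
    (le_max_right _ _)

theorem est_le_overestimation_mul (q : Fin n) : I.est q ≤ I.overestimation * I.proc q := by
  rw [← div_le_iff₀ (I.proc_pos q)]
  exact (le_ciSup (f := fun q => I.est q / I.proc q) (Set.finite_range _).bddAbove q).trans
    (le_max_right _ _)

/-- The 2 is the ratio between the endpoints of a class. The lower bound in
`one_le_mul_proc_mul_zpow` uses the other endpoint and loses no such factor. -/
theorem proc_mul_zpow_le (q : Fin n) :
    I.proc q * (2 : ℝ) ^ (-I.cls q) ≤ 2 * I.underestimation := by
  have h1 := I.proc_le_underestimation_mul q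
  have h2 := (I.cls_spec q).2.le
  have h3 : (0 : ℝ) < 2 ^ I.cls q := by positivity
  rw [zpow_add_one₀ two_ne_zero] at h2
  rw [zpow_neg, ← div_eq_mul_inv, div_le_iff₀ h3]
  have h4 := mul_le_mul_of_nonneg_left h2 (zero_le_one.trans I.one_le_underestimation)
  linarith

theorem one_le_mul_proc_mul_zpow (q : Fin n) :
    1 ≤ I.overestimation * (I.proc q * (2 : ℝ) ^ (-I.cls q)) := by
  have h3 : (0 : ℝ) < 2 ^ I.cls q := by positivity
  rw [zpow_neg, ← mul_assoc, ← div_eq_mul_inv, le_div_iff₀ h3, one_mul]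
  exact (I.cls_spec q).1.trans (I.est_le_overestimation_mul q)

end Input

theorem two_zpow_neg_eq_sum {c b : ℤ} (h : c ≤ b) :
    (2 : ℝ) ^ (-c) = ∑ i ∈ Finset.Ico c b, (2 : ℝ) ^ (-(i + 1)) + 2 ^ (-b) := by
  induction b, h using Int.leInduction with
  | base => simp
  | succ b hb ih =>
    have hI : Finset.Ico c (b + 1) = insert b (Finset.Ico c b) := by
      ext i
      simp only [Finset.mem_Ico, Finset.mem_insert]
      omega
    have h2 : (2 : ℝ) ^ (-b) = 2 ^ (-(b + 1)) * 2 := by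
      rw [← zpow_add_one₀ two_ne_zero]
      congr 1
      ring
    rw [ih, hI, Finset.sum_insert (by simp)]
    linarith

/-- Summation by parts for sums weighted by negative powers of two. -/
theorem sum_mul_two_zpow_neg {ι : Type*} (A : Finset ι) (f : ι → ℤ) (x : ι → ℝ) {a b : ℤ}
    (ha : ∀ q ∈ A, a ≤ f q) (hb : ∀ q ∈ A, f q ≤ b) :
    ∑ q ∈ A, x q * (2 : ℝ) ^ (-f q) =
      ∑ i ∈ Finset.Ico a b, (2 : ℝ) ^ (-(i + 1)) * ∑ q ∈ A with f q ≤ i, x q +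
        2 ^ (-b) * ∑ q ∈ A, x q := by
  have h1 : ∀ i : ℤ, (2 : ℝ) ^ (-(i + 1)) * ∑ q ∈ A with f q ≤ i, x q =
      ∑ q ∈ A, if f q ≤ i then x q * (2 : ℝ) ^ (-(i + 1)) else 0 := by
    intro i
    rw [Finset.mul_sum, Finset.sum_filter]
    exact Finset.sum_congr rfl fun q _ => by split_ifs <;> ring
  simp_rw [h1]
  rw [Finset.sum_comm, Finset.mul_sum, ← Finset.sum_add_distrib]
  refine Finset.sum_congr rfl fun q hq => ?_
  have h2 : (Finset.Ico a b).filter (fun i => f q ≤ i) = Finset.Ico (f q) b := by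
    ext i
    have := ha q hq
    simp only [Finset.mem_filter, Finset.mem_Ico]
    omega
  rw [← Finset.sum_filter, h2, ← Finset.mul_sum, two_zpow_neg_eq_sum (hb q hq)]
  ring

/-! ### Charging the full jobs to the jobs pending in `S`. -/

section Competitive

variable {n : ℕ} {I : Input n} {S : Schedule I} {st : State n}

open scoped Classical in
/-- The jobs pending in `S` at time `t`. -/
noncomputable def Schedule.pending (S : Schedule I) (t : ℝ) : Finset (Fin n) :=
  Finset.univ.filter fun q => I.release q ≤ t ∧ 0 < S.left q t

theorem Schedule.mem_pending {t : ℝ} {q : Fin n} :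
    q ∈ S.pending t ↔ I.release q ≤ t ∧ 0 < S.left q t := by
  simp [Schedule.pending]

theorem exists_isOwner {i : ℤ} {Z : Fin n} (hZ : IsZig I st Z) (hi : i < I.cls Z) :
    ∃ Y, IsOwner I st i Y := by
  classical
  obtain ⟨Y, hY, hmin⟩ := Finset.exists_min_image
    (Finset.univ.filter fun Z => IsZig I st Z ∧ i < I.cls Z) I.cls ⟨Z, by simp [hZ, hi]⟩
  simp only [Finset.mem_filter, Finset.mem_univ, true_and] at hY hmin
  exact ⟨Y, hY.1, hY.2, fun Z' h1 h2 => hmin Z' ⟨h1, h2⟩⟩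

/-- A positive excess is caused by a job pending in `S` whose class has the same owner. -/
theorem exists_pending_isOwner (hc : Coherent I st) (h : Controlled S st) {i : ℤ}
    (hi : 0 < excess S st i) :
    ∃ Z, IsOwner I st i Z ∧ ∃ o ∈ S.pending st.time, IsOwner I st (I.cls o) Z := by
  obtain ⟨Y, hY, hiY⟩ : ∃ Y, IsZig I st Y ∧ i < I.cls Y := by
    by_contra! hne
    exact absurd hi (not_lt.2 (h.above_zigs i hne))
  obtain ⟨Z, hZ⟩ := exists_isOwner hY hiY
  -- The excess is positive at `i` and nonpositive just below `Z`, so on some job in between `S` has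
  -- more work left than the algorithm.
  obtain ⟨o, ho1, ho2, ho3⟩ : ∃ o, i < I.cls o ∧ I.cls o ≤ I.cls Z - 1 ∧
      st.rem o < S.left o st.time := by
    by_contra! hne
    refine absurd hi (not_lt.2 (le_trans ?_ (h.below_zig Z hZ.1)))
    refine Finset.sum_le_sum_of_subset_of_nonneg (fun q hq => ?_) fun q hq hq' => ?_
    · have := hZ.2.1
      simp only [Finset.mem_filter, Finset.mem_univ, true_and] at hq ⊢
      omega
    · simp only [Finset.mem_filter, Finset.mem_univ, true_and, not_le] at hq hq'
      exact sub_nonneg.2 (hne q hq' hq)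
  refine ⟨Z, hZ, o, Schedule.mem_pending.2 ⟨?_, (hc.rem_nonneg o).trans_lt ho3⟩, hZ.1, by omega,
    fun Z' h1 h2 => hZ.2.2 Z' h1 (ho1.trans h2)⟩
  by_contra! hrel
  rw [hc.rem_of_full o (hc.full_of_unreleased o hrel)] at ho3
  exact absurd (S.left_le_proc o st.time) (not_le.2 ho3)

/-- Each job `o` of `S` carries the set of the owner of its class. As `B o` is independent of `i`,
the later sum over all levels does not pay for the number of classes. -/
theorem exists_excess_le (hc : Coherent I st) (h : Controlled S st) :
    ∃ B : Fin n → Finset (Fin n), (∀ o, (B o).card ≤ 2) ∧ ∀ i,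
      excess S st i ≤ ∑ o ∈ S.pending st.time, ∑ q ∈ B o with I.cls q ≤ i, I.proc q := by
  have key : ∀ o, ∃ B : Finset (Fin n), B.card ≤ 2 ∧ ∀ Z, IsOwner I st (I.cls o) Z →
      ∀ i, IsOwner I st i Z → excess S st i ≤ ∑ q ∈ B with I.cls q ≤ i, I.proc q := by
    intro o
    by_cases ho : ∃ Z, IsOwner I st (I.cls o) Z
    · obtain ⟨Z, hZ⟩ := ho
      obtain ⟨B, hB, hB'⟩ := h.owner Z hZ.1
      refine ⟨B, hB, fun Z' hZ' => ?_⟩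
      -- Owners are unique because partial jobs have distinct classes.
      have hZZ := hc.cls_inj Z' hZ'.1.1 Z hZ.1.1
        (le_antisymm (hZ'.2.2 Z hZ.1 hZ.2.1) (hZ.2.2 Z' hZ'.1 hZ'.2.1))
      rw [hZZ]
      exact hB'
    · exact ⟨∅, by simp, fun Z hZ => absurd ⟨Z, hZ⟩ ho⟩
  choose B hB hB' using key
  refine ⟨B, hB, fun i => ?_⟩
  have hnn : ∀ o ∈ S.pending st.time, 0 ≤ ∑ q ∈ B o with I.cls q ≤ i, I.proc q :=
    fun o _ => sum_proc_nonneg _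
  rcases le_or_gt (excess S st i) 0 with hi | hi
  · exact hi.trans (Finset.sum_nonneg hnn)
  · obtain ⟨Z, hZ, o, ho, hoZ⟩ := exists_pending_isOwner hc h hi
    exact (hB' o Z hoZ i hZ).trans (Finset.single_le_sum hnn ho)

theorem sum_proc_mul_zpow_le (B : Finset (Fin n)) :
    ∑ q ∈ B, I.proc q * (2 : ℝ) ^ (-I.cls q) ≤ B.card * (2 * I.underestimation) := by
  rw [← nsmul_eq_mul]
  exact Finset.sum_le_card_nsmul _ _ _ fun q _ => I.proc_mul_zpow_le q

theorem sum_sub_left_nonpos (h : Controlled S st) :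
    ∑ q, (st.rem q - S.left q st.time) ≤ 0 := by
  obtain ⟨b, hb⟩ := (Set.finite_range I.cls).bddAbove
  have hb : ∀ q, I.cls q ≤ b := fun q => hb ⟨q, rfl⟩
  have := h.above_zigs b fun Z _ => hb Z
  rwa [excess, Finset.filter_true_of_mem fun q _ => hb q] at this

/-- Summation by parts writes the weighted sum as a nonnegative combination of excesses. Each is
bounded through the sets `B o`, and undoing the summation on `B o` leaves the weight of at most two
jobs, 2·2μ₁. -/
theorem sum_sub_left_mul_zpow_le (hc : Coherent I st) (h : Controlled S st) :
    ∑ q, (st.rem q - S.left q st.time) * (2 : ℝ) ^ (-I.cls q) ≤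
      (S.pending st.time).card * (4 * I.underestimation) := by
  obtain ⟨b, hb⟩ := (Set.finite_range I.cls).bddAbove
  obtain ⟨a, ha⟩ := (Set.finite_range I.cls).bddBelow
  have hb : ∀ q, I.cls q ≤ b := fun q => hb ⟨q, rfl⟩
  have ha : ∀ q, a ≤ I.cls q := fun q => ha ⟨q, rfl⟩
  obtain ⟨B, hB, hB'⟩ := exists_excess_le hc h
  have hB2 : ∀ o, ∑ i ∈ Finset.Ico a b,
      (2 : ℝ) ^ (-(i + 1)) * ∑ q ∈ B o with I.cls q ≤ i, I.proc q ≤ 4 * I.underestimation := by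
    intro o
    have h1 := sum_mul_two_zpow_neg (B o) I.cls I.proc (fun q _ => ha q) (fun q _ => hb q)
    have h2 := sum_proc_mul_zpow_le (I := I) (B o)
    have h3 : (0 : ℝ) ≤ 2 ^ (-b) * ∑ q ∈ B o, I.proc q :=
      mul_nonneg (by positivity) (sum_proc_nonneg _)
    have h4 : ((B o).card : ℝ) * (2 * I.underestimation) ≤ 2 * (2 * I.underestimation) :=
      mul_le_mul_of_nonneg_right (by exact_mod_cast hB o)
        (by linarith [I.one_le_underestimation])
    linarith
  rw [sum_mul_two_zpow_neg Finset.univ I.cls _ (fun q _ => ha q) (fun q _ => hb q)]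
  have h1 : (2 : ℝ) ^ (-b) * ∑ q, (st.rem q - S.left q st.time) ≤ 0 :=
    mul_nonpos_of_nonneg_of_nonpos (by positivity) (sum_sub_left_nonpos h)
  have h2 : ∑ i ∈ Finset.Ico a b, (2 : ℝ) ^ (-(i + 1)) * excess S st i ≤
      ∑ i ∈ Finset.Ico a b, ∑ o ∈ S.pending st.time,
        (2 : ℝ) ^ (-(i + 1)) * ∑ q ∈ B o with I.cls q ≤ i, I.proc q := by
    refine Finset.sum_le_sum fun i _ => ?_
    rw [← Finset.mul_sum]
    exact mul_le_mul_of_nonneg_left (hB' i) (by positivity)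
  rw [Finset.sum_comm] at h2
  have h3 := h2.trans (Finset.sum_le_card_nsmul _ _ _ fun o _ => hB2 o)
  rw [nsmul_eq_mul] at h3
  unfold excess at h3
  linarith

/-- A full job retains all its work and hence weight at least 1/μ₂. The 6 is 4 from the weighted
excess plus 2 from the jobs pending in `S`. -/
theorem card_fullJobs_le (hc : Coherent I st) (h : Controlled S st) :
    ((fullJobs I st).card : ℝ) ≤ 6 * I.distortion * (S.pending st.time).card := by
  classical
  have h1 : ((fullJobs I st).card : ℝ) ≤
      I.overestimation * ∑ q ∈ fullJobs I st, st.rem q * (2 : ℝ) ^ (-I.cls q) := by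
    rw [Finset.mul_sum, ← nsmul_one]
    refine Finset.card_nsmul_le_sum _ _ _ fun q hq => ?_
    rw [hc.rem_of_full q (mem_fullJobs.1 hq).2]
    exact I.one_le_mul_proc_mul_zpow q
  have h2 : ∑ q ∈ fullJobs I st, st.rem q * (2 : ℝ) ^ (-I.cls q) ≤
      ∑ q, (st.rem q - S.left q st.time) * (2 : ℝ) ^ (-I.cls q) +
        ∑ q ∈ S.pending st.time, I.proc q * (2 : ℝ) ^ (-I.cls q) := by
    have hite : ∀ (A : Finset (Fin n)) (f : Fin n → ℝ),
        ∑ q ∈ A, f q = ∑ q, if q ∈ A then f q else 0 := fun A f => by simp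
    rw [hite (fullJobs I st), hite (S.pending st.time), ← Finset.sum_add_distrib]
    refine Finset.sum_le_sum fun q _ => ?_
    have hw : (0 : ℝ) ≤ 2 ^ (-I.cls q) := by positivity
    have hp := mul_nonneg (I.proc_pos q).le hw
    rcases le_or_gt (I.release q) st.time with hq | hq
    · have hr := mul_nonneg (hc.rem_nonneg q) hw
      rcases (S.left_nonneg q st.time).eq_or_lt with hl | hl
      · rw [← hl, sub_zero]
        split_ifs <;> linarith
      · have hl' := mul_le_mul_of_nonneg_right (S.left_le_proc q st.time) hw
        rw [if_pos (Schedule.mem_pending.2 ⟨hq, hl⟩), sub_mul]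
        split_ifs <;> linarith
    · have hf : q ∉ fullJobs I st := fun hf =>
        absurd (mem_pendingJobs.1 (mem_fullJobs.1 hf).1).1 (not_le.2 hq)
      rw [if_neg hf, hc.rem_of_full q (hc.full_of_unreleased q hq), S.left_eq_proc hq.le, sub_self,
        zero_mul, zero_add]
      split_ifs <;> linarith
  have h3 := sum_sub_left_mul_zpow_le hc h
  have h4 := sum_proc_mul_zpow_le (I := I) (S.pending st.time)
  have h5 := mul_le_mul_of_nonneg_left (h2.trans (add_le_add h3 h4))
    (zero_le_one.trans I.one_le_overestimation)
  unfold Input.distortion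
  linarith

/-- Needed separately, because the additive 2 of `Coherent.card_pendingJobs_le` cannot be charged
when `S` has no pending job. The total excess is nonpositive while every term is nonnegative, so
every term vanishes. -/
theorem pendingJobs_eq_empty (hc : Coherent I st) (h : Controlled S st)
    (hS : S.pending st.time = ∅) : pendingJobs I st = ∅ := by
  have hleft : ∀ q, I.release q ≤ st.time → S.left q st.time = 0 := fun q hq => by
    refine le_antisymm (not_lt.1 fun hl => ?_) (S.left_nonneg q _)
    have := Schedule.mem_pending.2 ⟨hq, hl⟩
    simp [hS] at this
  have hnn : ∀ q ∈ Finset.univ, 0 ≤ st.rem q - S.left q st.time := fun q _ => by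
    rcases le_or_gt (I.release q) st.time with hq | hq
    · rw [hleft q hq, sub_zero]
      exact hc.rem_nonneg q
    · rw [hc.rem_of_full q (hc.full_of_unreleased q hq), S.left_eq_proc hq.le, sub_self]
  have hz := (Finset.sum_eq_zero_iff_of_nonneg hnn).1
    (le_antisymm (sum_sub_left_nonpos h) (Finset.sum_nonneg hnn))
  rw [Finset.eq_empty_iff_forall_notMem]
  intro q hq
  rw [mem_pendingJobs] at hq
  have := hz q (Finset.mem_univ q)
  rw [hleft q hq.1, sub_zero] at this
  exact hq.2.ne' this

/-- At every time, the algorithm has at most `O(distortion)` times as many pending jobs as any other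
schedule. -/
theorem numPending_zigzag_le (tb : TieBreak n) (S : Schedule I) (t : ℝ) :
    ((zigzag I tb).numPending t : ℝ) ≤ 32 * I.distortion * S.numPending t := by
  rcases lt_or_ge t 0 with ht | ht
  · simp [Schedule.numPending_of_neg _ ht]
  obtain ⟨st, rfl, hst⟩ := exists_reachable tb S ht
  have hS : S.numPending st.time = (S.pending st.time).card := S.numPending_eq ht
  rw [hS]
  have h1 : ((zigzag I tb).numPending st.time : ℝ) ≤ (pendingJobs I st).card := by
    exact_mod_cast hst.numPending_le ht
  refine h1.trans ?_
  rcases (S.pending st.time).eq_empty_or_nonempty with he | hne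
  · simp [pendingJobs_eq_empty hst.coherent hst.controlled he, he]
  · have h2 := card_fullJobs_le hst.coherent hst.controlled
    have h3 : ((pendingJobs I st).card : ℝ) ≤ 5 * (fullJobs I st).card + 2 := by
      exact_mod_cast hst.coherent.card_pendingJobs_le
    have h4 : (1 : ℝ) ≤ (S.pending st.time).card := by
      exact_mod_cast hne.card_pos
    -- The additive 2 is absorbed by twice distortion times the number of jobs of `S`: 32 = 5·6 + 2.
    have h5 := one_le_mul_of_one_le_of_one_le I.one_le_distortion h4
    linarith

end Competitive

end ZigZagScheduling

/-! ### From the bound at every time to total flow time. -/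

theorem mainTheorem1 :
    ∃ C : ℝ, 0 < C ∧
      ∀ (μ : ℝ) (n : ℕ) (I : ZigZagScheduling.Input n) (tb : ZigZagScheduling.TieBreak n),
        I.distortion ≤ μ →
          (ZigZagScheduling.zigzag I tb).totalFlow ≤
              ENNReal.ofReal (C * (μ * (1 + Real.log μ))) * ZigZagScheduling.opt I ∧
          ∀ (S : ZigZagScheduling.Schedule I) (t : ℝ),
            ((ZigZagScheduling.zigzag I tb).numPending t : ℝ) ≤
              C * (μ * (1 + Real.log μ)) * (S.numPending t : ℝ) := by
  refine ⟨32, by norm_num, fun μ n I tb hμ => ?_⟩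
  have h1 : 1 ≤ μ := I.one_le_distortion.trans hμ
  have hC : 32 * I.distortion ≤ 32 * (μ * (1 + Real.log μ)) := by
    -- The logarithm is mere slack, nonnegative since `μ ≥ 1`.
    have h2 : μ * 1 ≤ μ * (1 + Real.log μ) :=
      mul_le_mul_of_nonneg_left (by linarith [Real.log_nonneg h1]) (by linarith)
    linarith
  have hlocal : ∀ (S : ZigZagScheduling.Schedule I) (t : ℝ),
      ((ZigZagScheduling.zigzag I tb).numPending t : ℝ) ≤
        32 * (μ * (1 + Real.log μ)) * (S.numPending t : ℝ) := fun S t =>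
    (ZigZagScheduling.numPending_zigzag_le tb S t).trans
      (mul_le_mul_of_nonneg_right hC (Nat.cast_nonneg _))
  refine ⟨?_, hlocal⟩
  have hpos : 0 < ENNReal.ofReal (32 * (μ * (1 + Real.log μ))) :=
    ENNReal.ofReal_pos.2 (by linarith [I.one_le_distortion])
  unfold ZigZagScheduling.opt
  rw [ENNReal.mul_iInf_of_ne hpos.ne' ENNReal.ofReal_ne_top]
  refine le_iInf fun S => ?_
  rw [ZigZagScheduling.Schedule.totalFlow_eq_lintegral,
    ZigZagScheduling.Schedule.totalFlow_eq_lintegral,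
    ← MeasureTheory.lintegral_const_mul' _ _ ENNReal.ofReal_ne_top]
  refine MeasureTheory.lintegral_mono fun t => ?_
  rw [← ENNReal.ofReal_natCast, ← ENNReal.ofReal_natCast, ← ENNReal.ofReal_mul (by
    linarith [I.one_le_distortion])]
  exact ENNReal.ofReal_le_ofReal (hlocal S t)
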